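/- **Setting.** A *Markov polycategory* has objects $X$ with standard Borel spaces $\underline X$ and, for ordered tuples (profiles) $\mathbf A,\mathbf B$ of objects, possibly empty, a set of morphisms $\mathbf A\to\mathbf B$, each a Markov kernel from $\underline{\mathbf A}=\prod_r\underline A_r$ to $\underline{\mathbf B}$. It contains the identity kernels $(X)\to(X)$ and is closed under *kernel slotwise composition*: for $k:\mathbf A\to\mathbf B$ and $l:\mathbf C\to\mathbf D$ with $B_i=C_j$, the kernel $l\circ_{(i,j)}k$ draws $\mathbf b$ from $k$, then $\mathbf d$ from $l$ with $b_i$ in its $j$-th input, and keeps $\mathbf d$ and the entries of $\mathbf b$ other than $b_i$. Its input profile is $(C_1,\dots,C_{j-1},\mathbf A,C_{j+1},\dots,C_q)$ and its output profile is $(B_1,\dots,B_{i-1},\mathbf D,B_{i+1},\dots,B_n)$. A *colored Markov polycategory* (CMP) $\mathcal P$ is a Markov polycategory together with object colors $\chi(X)$ in a category, compatible morphism colors in an ordered polycategory, sets $\mathrm{Int}_{\mathcal P}(B,C)\subseteq\mathrm{Hom}(\chi(B),\chi(C))$ of admissible interface witnesses, and interface kernels $\kappa_{f;B,C}:(B)\to(C)$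 for $f\in\mathrm{Int}_{\mathcal P}(B,C)$, which are morphisms of $\mathcal P$ and are coherent with identities and composition. *Colored kernel slotwise composition* (CKSC) along $f\in\mathrm{Int}_{\mathcal P}(B_i,C_j)$ is $$l\circ^f_{(i,j)}k=l\circ_{(i,j)}\bigl(\kappa_{f;B_i,C_j}\circ_{(i,1)}k\bigr).$$ A *finite acyclic CKSC diagram* $D$ has finitely many vertices $u$ labelled by morphisms $k_u:\mathbf A_u\to\mathbf B_u$ of $\mathcal P$, and finitely many internal wires $((u,p),(v,q),f)$ with $f\in\mathrm{Int}_{\mathcal P}(B_{u,p},A_{v,q})$. Each slot lies on at most one wire, the induced directed graph on vertices is acyclic, and the unconnected (external) input slots and output slots are listed in chosen orders, which give the external profiles $\mathbf I_D,\mathbf O_D$. The *trace kernel* $K_D:\mathbf I_D\to\mathbf O_D$ is obtained by inserting on every internal wire a unary vertex labelled by its interface kernel, sampling the outputs of all vertices successively along a topological ordering, and taking the law of the external outputs. An *iterated CKSC expression* in $D$ is either a vertex $u$, with its ordered input and output slots as external slots and with value $k_u$, or $E_2\circ^f_{(i,j)}E_1$, where $f$ is the witness of an internal wire of $D$ from the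 $i$-th external output slot of $E_1$ to the $j$-th external input slot of $E_2$; its ordered lists of external slots and its value are given by CKSC. It is a *well-formed expression for $D$* if every vertex and every internal wire of $D$ occurs in it exactly once, and its ordered lists of external input slots and external output slots are the chosen lists of $D$. **Corollary (Associativity and interchange for CKSC).** Let $\mathcal P$ be a CMP. 1. For every finite acyclic CKSC diagram $D$ in $\mathcal P$, the value of every well-formed expression for $D$ is the trace kernel $K_D$, whichever topological ordering is used to evaluate $K_D$. In particular, any two well-formed expressions for $D$ have the same value. 2. CKSC satisfies the associativity and interchange laws for ordered typed diagrams: - *Associativity.* For $k:\mathbf A\to\mathbf B$, $l:\mathbf C\to\mathbf D$, $m:\mathbf E\to\mathbf F$, $f\in\mathrm{Int}_{\mathcal P}(B_i,C_j)$ and $g\in\mathrm{Int}_{\mathcal P}(D_p,E_q)$, $$m\circ^g_{(i-1+p,\,q)}(l\circ^f_{(i,j)}k)=(m\circ^g_{(p,q)}l)\circ^f_{(i,\,q-1+j)}k.$$ - *Interchange at outputs.* Composing $k$ with $l$ at one of its output slots and with $l'$ at another one gives the same kernel in either order, whenever the two iterated composites list their external input slots in the same order (that is, $l$ or $l'$ has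 no input before its connected slot, and $l$ or $l'$ has no input after its connected slot). - *Interchange at inputs.* Composing $l$ with $k$ at one of its input slots and with $k'$ at another one gives the same kernel in either order, whenever the two iterated composites list their external output slots in the same order (that is, $k$ or $k'$ has no output before its connected slot, and $k$ or $k'$ has no output after its connected slot). -/

import Mathlib

open MeasureTheory ProbabilityTheory

universe u v w x y z

/-! ## Ordered profiles and slotwise connections -/

/-- A choice of an output slot, carrying `b`, of an output profile `B`, and of an input slot,
carrying `c`, of an input profile `C`, for boxes `k : A → B` and `l : C → D`.  The slots are given by
the decompositions `B = B₁ ++ b :: B₂` and `C = C₁ ++ c :: C₂`, so that in the usual notation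
`i = |B₁| + 1` and `j = |C₁| + 1`.  The profiles `Γ` and `Δ` are those of the composite along
`(i, j)`, obtained by the insertion convention. -/
structure SlotPair {Ob : Type u} (A B C D Γ Δ : List Ob) (b c : Ob) where
  B₁ : List Ob
  B₂ : List Ob
  C₁ : List Ob
  C₂ : List Ob
  hB : B = B₁ ++ b :: B₂
  hC : C = C₁ ++ c :: C₂
  hΓ : Γ = C₁ ++ A ++ C₂
  hΔ : Δ = B₁ ++ D ++ B₂

/-- The image of a pair of slots under a map of objects. -/
def SlotPair.map {Ob : Type u} {Ob' : Type v} (χ : Ob → Ob') {A B C D Γ Δ : List Ob} {b c : Ob}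
    (s : SlotPair A B C D Γ Δ b c) :
    SlotPair (A.map χ) (B.map χ) (C.map χ) (D.map χ) (Γ.map χ) (Δ.map χ) (χ b) (χ c) where
  B₁ := s.B₁.map χ
  B₂ := s.B₂.map χ
  C₁ := s.C₁.map χ
  C₂ := s.C₂.map χ
  hB := by simp [s.hB]
  hC := by simp [s.hC]
  hΓ := by simp [s.hΓ]
  hΔ := by simp [s.hΔ]

/-- Ordered polycategories: profiles are ordered lists, and composition connects one output slot to
one input slot carrying the same object.  `comp s k l` is `l ∘_{(i,j)} k`.  In the two interchange
laws, the conditions on empty lists say that the two iterated composites list their external wires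
in the same order. -/
structure OrderedPolycategory (Ob : Type u) where
  Hom : List Ob → List Ob → Type v
  id : ∀ X : Ob, Hom [X] [X]
  comp : ∀ {A B C D Γ Δ : List Ob} {b : Ob}, SlotPair A B C D Γ Δ b b →
    Hom A B → Hom C D → Hom Γ Δ
  id_comp : ∀ {A₁ A₂ B : List Ob} {a : Ob} (h : Hom (A₁ ++ a :: A₂) B),
    comp ⟨[], [], A₁, A₂, rfl, rfl, by simp, by simp⟩ (id a) h = h
  comp_id : ∀ {A B₁ B₂ : List Ob} {b : Ob} (h : Hom A (B₁ ++ b :: B₂)),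
    comp ⟨B₁, B₂, [], [], rfl, rfl, by simp, by simp⟩ h (id b) = h
  assoc : ∀ {A B₁ B₂ C₁ C₂ D₁ D₂ E₁ E₂ F : List Ob} {b d : Ob}
    (k : Hom A (B₁ ++ b :: B₂)) (l : Hom (C₁ ++ b :: C₂) (D₁ ++ d :: D₂))
    (m : Hom (E₁ ++ d :: E₂) F),
    (comp ⟨B₁ ++ D₁, D₂ ++ B₂, E₁, E₂, by simp, rfl, by simp, by simp⟩
        (comp ⟨B₁, B₂, C₁, C₂, rfl, rfl, rfl, rfl⟩ k l) m
      : Hom (E₁ ++ C₁ ++ A ++ C₂ ++ E₂) (B₁ ++ D₁ ++ F ++ D₂ ++ B₂)) =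
    comp ⟨B₁, B₂, E₁ ++ C₁, C₂ ++ E₂, rfl, by simp, by simp, by simp⟩
        k (comp ⟨D₁, D₂, E₁, E₂, rfl, rfl, rfl, rfl⟩ l m)
  interchange_out : ∀ {A B₁ B₂ B₃ C₁ C₂ D C₁' C₂' D' : List Ob} {b b' : Ob}
    (h₁ : C₁ = [] ∨ C₁' = []) (h₂ : C₂ = [] ∨ C₂' = [])
    (k : Hom A (B₁ ++ b :: B₂ ++ b' :: B₃)) (l : Hom (C₁ ++ b :: C₂) D)
    (l' : Hom (C₁' ++ b' :: C₂') D'),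
    (comp ⟨B₁ ++ D ++ B₂, B₃, C₁', C₂', by simp, rfl, by simp, rfl⟩
        (comp ⟨B₁, B₂ ++ b' :: B₃, C₁, C₂, by simp, rfl, rfl, rfl⟩ k l) l'
      : Hom (C₁' ++ C₁ ++ A ++ C₂ ++ C₂') (B₁ ++ D ++ B₂ ++ D' ++ B₃)) =
    comp ⟨B₁, B₂ ++ D' ++ B₃, C₁, C₂, by simp, rfl,
          by rcases h₁ with h | h <;> rcases h₂ with h' | h' <;> simp [h, h'], by simp⟩
        (comp ⟨B₁ ++ b :: B₂, B₃, C₁', C₂', rfl, rfl, rfl, rfl⟩ k l') l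
  interchange_in : ∀ {A B₁ B₂ A' B₁' B₂' C₁ C₂ C₃ D : List Ob} {b b' : Ob}
    (h₁ : B₁ = [] ∨ B₁' = []) (h₂ : B₂ = [] ∨ B₂' = [])
    (k : Hom A (B₁ ++ b :: B₂)) (k' : Hom A' (B₁' ++ b' :: B₂'))
    (l : Hom (C₁ ++ b :: C₂ ++ b' :: C₃) D),
    (comp ⟨B₁', B₂', C₁ ++ A ++ C₂, C₃, rfl, by simp, rfl, by simp⟩
        k' (comp ⟨B₁, B₂, C₁, C₂ ++ b' :: C₃, rfl, by simp, rfl, rfl⟩ k l)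
      : Hom (C₁ ++ A ++ C₂ ++ A' ++ C₃) (B₁' ++ B₁ ++ D ++ B₂ ++ B₂')) =
    comp ⟨B₁, B₂, C₁, C₂ ++ A' ++ C₃, rfl, by simp, by simp,
          by rcases h₁ with h | h <;> rcases h₂ with h' | h' <;> simp [h, h']⟩
        k (comp ⟨B₁', B₂', C₁ ++ b :: C₂, C₃, rfl, rfl, rfl, rfl⟩ k' l)

/-! ## Values of profiles -/

/-- The space underlying a profile: the product of the spaces of its entries, with the product
`σ`-algebra.  For the empty profile it is a one-point space. -/
abbrev Val {Ob : Type u} (U : Ob → Type v) (A : List Ob) : Type v :=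
  ∀ r : Fin A.length, U (A.get r)

/-- Transport of a value along an equality of objects. -/
def castObj {Ob : Type u} (U : Ob → Type v) {a b : Ob} (h : a = b) (t : U a) : U b := h ▸ t

namespace Val

variable {Ob : Type u} {U : Ob → Type v} {A B : List Ob} {a b : Ob}

/-- Transport of a tuple along an equality of profiles. -/
def cast (h : A = B) (t : Val U A) : Val U B := h ▸ t

/-- The first part of a tuple. -/
def left (t : Val U (A ++ B)) : Val U A := fun r =>
  castObj U (by simp) (t ⟨r, by have := r.2; simp only [List.length_append]; omega⟩)

/-- The second part of a tuple. -/
def right (t : Val U (A ++ B)) : Val U B := fun r =>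
  castObj U (by simp) (t ⟨A.length + r, by have := r.2; simp only [List.length_append]; omega⟩)

/-- Concatenation of tuples. -/
def append (s : Val U A) (t : Val U B) : Val U (A ++ B) := fun r =>
  if h : (r : ℕ) < A.length then castObj U (by simp [h]) (s ⟨r, h⟩)
  else castObj U (by simp [List.getElem_append_right (Nat.le_of_not_lt h)])
    (t ⟨r - A.length, by have := r.2; simp only [List.length_append] at this; omega⟩)

/-- The one-entry tuple. -/
def single (t : U a) : Val U [a] := fun r => castObj U (by simp) t

/-- The entry of a tuple in the slot that follows `A`. -/
def slot (t : Val U (A ++ b :: B)) : U b :=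
  castObj U (by simp) (t ⟨A.length, by simp⟩)

/-- The entries of a tuple behind the slot that follows `A`. -/
def after (t : Val U (A ++ b :: B)) : Val U B := fun r =>
  castObj U (by simp [List.getElem_append_right])
    (t ⟨A.length + (r + 1), by have := r.2; simp⟩)

end Val

section Measurability

variable {Ob : Type u} {U : Ob → Type v} [∀ X, MeasurableSpace (U X)] {A B : List Ob} {a b : Ob}
  {T : Type w} [MeasurableSpace T]

theorem measurable_castObj (h : a = b) : Measurable (castObj U h) := by
  subst h; exact measurable_id

theorem Val.measurable_cast (h : A = B) : Measurable (Val.cast (U := U) h) := by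
  subst h; exact measurable_id

theorem Val.measurable_left : Measurable (Val.left (U := U) (A := A) (B := B)) :=
  measurable_pi_lambda _ fun _ => (measurable_castObj _).comp (measurable_pi_apply _)

theorem Val.measurable_right : Measurable (Val.right (U := U) (A := A) (B := B)) :=
  measurable_pi_lambda _ fun _ => (measurable_castObj _).comp (measurable_pi_apply _)

theorem Val.measurable_slot : Measurable (Val.slot (U := U) (A := A) (B := B) (b := b)) :=
  (measurable_castObj _).comp (measurable_pi_apply _)

theorem Val.measurable_after : Measurable (Val.after (U := U) (A := A) (B := B) (b := b)) :=
  measurable_pi_lambda _ fun _ => (measurable_castObj _).comp (measurable_pi_apply _)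

theorem Val.measurable_single : Measurable (Val.single (U := U) (a := a)) :=
  measurable_pi_lambda _ fun _ => measurable_castObj _

theorem Val.measurable_append {s : T → Val U A} {t : T → Val U B} (hs : Measurable s)
    (ht : Measurable t) : Measurable fun p => Val.append (s p) (t p) := by
  refine measurable_pi_lambda _ fun r => ?_
  by_cases h : (r : ℕ) < A.length
  · simp only [Val.append, h, dite_true]
    exact (measurable_castObj _).comp ((measurable_pi_apply _).comp hs)
  · simp only [Val.append, h, dite_false]
    exact (measurable_castObj _).comp ((measurable_pi_apply _).comp ht)

end Measurability

/-! ## Kernel slotwise composition -/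

namespace SlotPair

variable {Ob : Type u} {U : Ob → Type v} {A B C D Γ Δ : List Ob} {b c : Ob}

/-- The inputs of `k` among the inputs of the composite. -/
def inK (s : SlotPair A B C D Γ Δ b c) (γ : Val U Γ) : Val U A :=
  (γ.cast s.hΓ).left.right

/-- The inputs of `l`, from the inputs of the composite and the value in the connected slot. -/
def inL (s : SlotPair A B C D Γ Δ b c) (γ : Val U Γ) (t : U c) : Val U C :=
  ((γ.cast s.hΓ).left.left.append
    (((Val.single t).append (γ.cast s.hΓ).right).cast (by simp : _ = c :: s.C₂))).cast s.hC.symm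

/-- The outputs of the composite, from those of `k` outside the connected slot and those of `l`. -/
def outKL (s : SlotPair A B C D Γ Δ b c) (β : Val U B) (δ : Val U D) : Val U Δ :=
  (((β.cast s.hB).left.append δ).append (β.cast s.hB).after).cast s.hΔ.symm

/-- The value of the connected output slot. -/
def atSlot (s : SlotPair A B C D Γ Δ b c) (β : Val U B) : U b := (β.cast s.hB).slot

variable [∀ X, MeasurableSpace (U X)]

theorem measurable_inK (s : SlotPair A B C D Γ Δ b c) : Measurable (s.inK (U := U)) :=
  Val.measurable_right.comp (Val.measurable_left.comp (Val.measurable_cast _))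

theorem measurable_atSlot (s : SlotPair A B C D Γ Δ b c) : Measurable (s.atSlot (U := U)) :=
  Val.measurable_slot.comp (Val.measurable_cast _)

theorem measurable_inL (s : SlotPair A B C D Γ Δ b c) :
    Measurable fun p : Val U Γ × U c => s.inL p.1 p.2 := by
  have h : Measurable fun p : Val U Γ × U c => p.1.cast s.hΓ :=
    (Val.measurable_cast _).comp measurable_fst
  exact (Val.measurable_cast _).comp (Val.measurable_append
    (Val.measurable_left.comp (Val.measurable_left.comp h))
    ((Val.measurable_cast _).comp (Val.measurable_append
      (Val.measurable_single.comp measurable_snd) (Val.measurable_right.comp h))))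

theorem measurable_outKL (s : SlotPair A B C D Γ Δ b c) :
    Measurable fun p : Val U B × Val U D => s.outKL p.1 p.2 := by
  have h : Measurable fun p : Val U B × Val U D => p.1.cast s.hB :=
    (Val.measurable_cast _).comp measurable_fst
  exact (Val.measurable_cast _).comp (Val.measurable_append
    (Val.measurable_append (Val.measurable_left.comp h) measurable_snd)
    (Val.measurable_after.comp h))

end SlotPair

/-- Kernel slotwise composition (KSC) `l ∘_{(i,j)} k`: draw `β` from `k` at the inputs of `k`, then
`δ` from `l` at its inputs, the `j`-th of which is the `i`-th entry of `β`, and keep `δ` and the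
entries of `β` other than the `i`-th. -/
noncomputable def kscKernel {Ob : Type u} {U : Ob → Type v} [∀ X, MeasurableSpace (U X)]
    {A B C D Γ Δ : List Ob} {b : Ob} (s : SlotPair A B C D Γ Δ b b)
    (k : Kernel (Val U A) (Val U B)) (l : Kernel (Val U C) (Val U D)) :
    Kernel (Val U Γ) (Val U Δ) :=
  ((k.comap s.inK s.measurable_inK).compProd
    (l.comap (fun p : Val U Γ × Val U B => s.inL p.1 (s.atSlot p.2))
      (s.measurable_inL.comp
        (measurable_fst.prodMk (s.measurable_atSlot.comp measurable_snd))))).map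
    fun p => s.outKL p.1 p.2

/-! ## Markov polycategories and colored Markov polycategories -/

/-- Markov polycategories: objects with standard Borel spaces, and sets of Markov kernels between
profiles that contain the identity kernels and are closed under KSC. -/
structure MarkovPolycategory where
  Ob : Type u
  U : Ob → Type v
  [meas : ∀ X, MeasurableSpace (U X)]
  [borel : ∀ X, StandardBorelSpace (U X)]
  hom : ∀ A B : List Ob, Set (Kernel (Val U A) (Val U B))
  markov : ∀ {A B : List Ob} {k : Kernel (Val U A) (Val U B)}, k ∈ hom A B → IsMarkovKernel k
  id_mem : ∀ X : Ob, (Kernel.id : Kernel (Val U [X]) (Val U [X])) ∈ hom [X] [X]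
  ksc_mem : ∀ {A B C D Γ Δ : List Ob} {b : Ob} (s : SlotPair A B C D Γ Δ b b)
    {k : Kernel (Val U A) (Val U B)} {l : Kernel (Val U C) (Val U D)},
    k ∈ hom A B → l ∈ hom C D → kscKernel s k l ∈ hom Γ Δ

attribute [instance] MarkovPolycategory.meas MarkovPolycategory.borel

namespace MarkovPolycategory

/-- The morphisms `A → B`. -/
def Mor (P : MarkovPolycategory.{u, v}) (A B : List P.Ob) : Type v := P.hom A B

variable {P : MarkovPolycategory.{u, v}} {A B C D Γ Δ : List P.Ob}

/-- The underlying Markov kernel of a morphism. -/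
def Mor.ker (k : P.Mor A B) : Kernel (Val P.U A) (Val P.U B) := k.1

instance (k : P.Mor A B) : IsMarkovKernel k.ker := P.markov k.2

/-- The identity morphism. -/
noncomputable def idMor (P : MarkovPolycategory.{u, v}) (X : P.Ob) : P.Mor [X] [X] :=
  ⟨Kernel.id, P.id_mem X⟩

/-- KSC of morphisms: `ksc s k l` is `l ∘_{(i,j)} k`. -/
noncomputable def ksc {b : P.Ob} (s : SlotPair A B C D Γ Δ b b) (k : P.Mor A B) (l : P.Mor C D) :
    P.Mor Γ Δ :=
  ⟨kscKernel s k.ker l.ker, P.ksc_mem s k.2 l.2⟩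

/-- Transport of a morphism along equalities of profiles. -/
def Mor.cast {A' B' : List P.Ob} (hA : A = A') (hB : B = B') (k : P.Mor A B) : P.Mor A' B' :=
  hA ▸ hB ▸ k

end MarkovPolycategory

/-- Color systems: a category `K` of object colors, an ordered polycategory `M` of morphism colors
on the same objects, and an assignment `ι` of unary morphism colors to the morphisms of `K`, which
respects identities and composition. -/
structure ColorSystem where
  K : Type u
  [cat : CategoryTheory.Category.{v} K]
  M : OrderedPolycategory.{u, w} K
  ι : ∀ {a b : K}, (a ⟶ b) → M.Hom [a] [b]
  ι_id : ∀ a : K, ι (CategoryTheory.CategoryStruct.id a) = M.id a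
  ι_comp : ∀ {a b c : K} (f : a ⟶ b) (g : b ⟶ c),
    ι (CategoryTheory.CategoryStruct.comp f g) =
      M.comp ⟨[], [], [], [], rfl, rfl, rfl, rfl⟩ (ι f) (ι g)

attribute [instance] ColorSystem.cat

/-- Colored Markov polycategories (CMPs) over a color system: a Markov polycategory with object
colors `χ`, morphism colors `ψ`, and an interface system, that is, sets `Int B C` of admissible
interface witnesses with interface kernels `κ`, coherent with identities and composition. -/
structure CMP (S : ColorSystem.{x, y, z}) extends MarkovPolycategory.{u, v} where
  χ : Ob → S.K
  ψ : ∀ {A B : List Ob}, toMarkovPolycategory.Mor A B → S.M.Hom (A.map χ) (B.map χ)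
  ψ_id : ∀ X : Ob, ψ (toMarkovPolycategory.idMor X) = S.M.id (χ X)
  ψ_ksc : ∀ {A B C D Γ Δ : List Ob} {b : Ob} (s : SlotPair A B C D Γ Δ b b)
    (k : toMarkovPolycategory.Mor A B) (l : toMarkovPolycategory.Mor C D),
    ψ (MarkovPolycategory.ksc s k l) = S.M.comp (s.map χ) (ψ k) (ψ l)
  Int : ∀ B C : Ob, Set (χ B ⟶ χ C)
  κ : ∀ {B C : Ob}, Int B C → toMarkovPolycategory.Mor [B] [C]
  ψ_κ : ∀ {B C : Ob} (f : Int B C), ψ (κ f) = S.ι f.1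
  id_mem_Int : ∀ B : Ob, CategoryTheory.CategoryStruct.id (χ B) ∈ Int B B
  κ_id : ∀ B : Ob, κ ⟨_, id_mem_Int B⟩ = toMarkovPolycategory.idMor B
  κ_comp : ∀ {B C D : Ob} (f : Int B C) (g : Int C D)
    (h : CategoryTheory.CategoryStruct.comp f.1 g.1 ∈ Int B D),
    κ ⟨_, h⟩ = MarkovPolycategory.ksc ⟨[], [], [], [], rfl, rfl, rfl, rfl⟩ (κ f) (κ g)

namespace CMP

variable {S : ColorSystem.{x, y, z}} (P : CMP.{u, v} S)

/-- Colored kernel slotwise composition (CKSC): `P.cksc s f k l` is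
`l ∘^f_{(i,j)} k = l ∘_{(i,j)} (κ_f ∘_{(i,1)} k)`. -/
noncomputable def cksc {A B C D Γ Δ : List P.Ob} {b c : P.Ob} (s : SlotPair A B C D Γ Δ b c)
    (f : P.Int b c) (k : P.Mor A B) (l : P.Mor C D) : P.Mor Γ Δ :=
  MarkovPolycategory.ksc
    (⟨s.B₁, s.B₂, s.C₁, s.C₂, rfl, s.hC, s.hΓ, s.hΔ⟩ :
      SlotPair A (s.B₁ ++ c :: s.B₂) C D Γ Δ c c)
    (MarkovPolycategory.ksc
      (⟨s.B₁, s.B₂, [], [], s.hB, rfl, by simp, by simp⟩ :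
        SlotPair A B [b] [c] A (s.B₁ ++ c :: s.B₂) b b)
      k (P.κ f))
    l

/-- Associativity of CKSC: `m ∘^g (l ∘^f k) = (m ∘^g l) ∘^f k`. -/
def CKSCAssociative : Prop :=
  ∀ {A B₁ B₂ C₁ C₂ D₁ D₂ E₁ E₂ F : List P.Ob} {b c d e : P.Ob} (f : P.Int b c) (g : P.Int d e)
    (k : P.Mor A (B₁ ++ b :: B₂)) (l : P.Mor (C₁ ++ c :: C₂) (D₁ ++ d :: D₂))
    (m : P.Mor (E₁ ++ e :: E₂) F),
    (P.cksc ⟨B₁ ++ D₁, D₂ ++ B₂, E₁, E₂, by simp, rfl, by simp, by simp⟩ g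
        (P.cksc ⟨B₁, B₂, C₁, C₂, rfl, rfl, rfl, rfl⟩ f k l) m
      : P.Mor (E₁ ++ C₁ ++ A ++ C₂ ++ E₂) (B₁ ++ D₁ ++ F ++ D₂ ++ B₂)) =
    P.cksc ⟨B₁, B₂, E₁ ++ C₁, C₂ ++ E₂, rfl, by simp, by simp, by simp⟩ f
        k (P.cksc ⟨D₁, D₂, E₁, E₂, rfl, rfl, rfl, rfl⟩ g l m)

/-- Interchange of two CKSCs at different output slots of `k`, whenever the two iterated composites
list their external input wires in the same order. -/
def CKSCInterchangeOut : Prop :=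
  ∀ {A B₁ B₂ B₃ C₁ C₂ D C₁' C₂' D' : List P.Ob} {b c b' c' : P.Ob}
    (h₁ : C₁ = [] ∨ C₁' = []) (h₂ : C₂ = [] ∨ C₂' = []) (f : P.Int b c) (f' : P.Int b' c')
    (k : P.Mor A (B₁ ++ b :: B₂ ++ b' :: B₃)) (l : P.Mor (C₁ ++ c :: C₂) D)
    (l' : P.Mor (C₁' ++ c' :: C₂') D'),
    (P.cksc ⟨B₁ ++ D ++ B₂, B₃, C₁', C₂', by simp, rfl, by simp, rfl⟩ f'
        (P.cksc ⟨B₁, B₂ ++ b' :: B₃, C₁, C₂, by simp, rfl, rfl, rfl⟩ f k l) l'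
      : P.Mor (C₁' ++ C₁ ++ A ++ C₂ ++ C₂') (B₁ ++ D ++ B₂ ++ D' ++ B₃)) =
    P.cksc ⟨B₁, B₂ ++ D' ++ B₃, C₁, C₂, by simp, rfl,
          by rcases h₁ with h | h <;> rcases h₂ with h' | h' <;> simp [h, h'], by simp⟩ f
        (P.cksc ⟨B₁ ++ b :: B₂, B₃, C₁', C₂', rfl, rfl, rfl, rfl⟩ f' k l') l

/-- Interchange of two CKSCs at different input slots of `l`, whenever the two iterated composites
list their external output wires in the same order. -/
def CKSCInterchangeIn : Prop :=
  ∀ {A B₁ B₂ A' B₁' B₂' C₁ C₂ C₃ D : List P.Ob} {b c b' c' : P.Ob}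
    (h₁ : B₁ = [] ∨ B₁' = []) (h₂ : B₂ = [] ∨ B₂' = []) (f : P.Int b c) (f' : P.Int b' c')
    (k : P.Mor A (B₁ ++ b :: B₂)) (k' : P.Mor A' (B₁' ++ b' :: B₂'))
    (l : P.Mor (C₁ ++ c :: C₂ ++ c' :: C₃) D),
    (P.cksc ⟨B₁', B₂', C₁ ++ A ++ C₂, C₃, rfl, by simp, rfl, by simp⟩ f'
        k' (P.cksc ⟨B₁, B₂, C₁, C₂ ++ c' :: C₃, rfl, by simp, rfl, rfl⟩ f k l)
      : P.Mor (C₁ ++ A ++ C₂ ++ A' ++ C₃) (B₁' ++ B₁ ++ D ++ B₂ ++ B₂')) =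
    P.cksc ⟨B₁, B₂, C₁, C₂ ++ A' ++ C₃, rfl, by simp, by simp,
          by rcases h₁ with h | h <;> rcases h₂ with h' | h' <;> simp [h, h']⟩ f
        k (P.cksc ⟨B₁', B₂', C₁ ++ c :: C₂, C₃, rfl, rfl, rfl, rfl⟩ f' k' l)

end CMP

/-! ## Finite acyclic diagrams -/

/-- Finite acyclic linear wiring between vertices with ordered profiles.  A slot is a vertex with a
position.  Injectivity of `src` and `tgt` is linearity of the wires.  The slots not met by internal
wires are external, and they are listed in a chosen order. -/
structure Wiring (Ob : Type u) where
  V : Type w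
  [fin : Finite V]
  inp : V → List Ob
  out : V → List Ob
  /-- The internal wires. -/
  W : Type w
  src : W → Σ a : V, Fin (out a).length
  tgt : W → Σ a : V, Fin (inp a).length
  src_inj : Function.Injective src
  tgt_inj : Function.Injective tgt
  acyclic : ∀ a : V, ¬ Relation.TransGen (fun a b => ∃ e, (src e).1 = a ∧ (tgt e).1 = b) a a
  extIn : List (Σ a : V, Fin (inp a).length)
  extIn_nodup : extIn.Nodup
  mem_extIn : ∀ s, s ∈ extIn ↔ ∀ e, tgt e ≠ s
  extOut : List (Σ a : V, Fin (out a).length)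
  extOut_nodup : extOut.Nodup
  mem_extOut : ∀ s, s ∈ extOut ↔ ∀ e, src e ≠ s

attribute [instance] Wiring.fin

namespace Wiring

variable {Ob : Type u} (G : Wiring.{u, w} Ob)

/-- Input slots. -/
abbrev InSlot := Σ a : G.V, Fin (G.inp a).length

/-- Output slots. -/
abbrev OutSlot := Σ a : G.V, Fin (G.out a).length

/-- The object carried by an input slot. -/
def inOb (s : G.InSlot) : Ob := (G.inp s.1).get s.2

/-- The object carried by an output slot. -/
def outOb (s : G.OutSlot) : Ob := (G.out s.1).get s.2

/-- The input slots of a vertex, in order. -/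
def inSlots (a : G.V) : List G.InSlot := (List.finRange _).map fun p => ⟨a, p⟩

/-- The output slots of a vertex, in order. -/
def outSlots (a : G.V) : List G.OutSlot := (List.finRange _).map fun p => ⟨a, p⟩

theorem map_inSlots (a : G.V) : (G.inSlots a).map G.inOb = G.inp a := by
  simp only [inSlots, List.map_map, Function.comp_def, inOb]
  exact List.map_get_finRange _

theorem map_outSlots (a : G.V) : (G.outSlots a).map G.outOb = G.out a := by
  simp only [outSlots, List.map_map, Function.comp_def, outOb]
  exact List.map_get_finRange _

/-- Topological orderings: enumerations of the vertices in which every wire goes forward. -/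
structure TopOrder where
  rank : G.V ≃ Fin (Nat.card G.V)
  lt : ∀ e, rank (G.src e).1 < rank (G.tgt e).1

/-- A finite acyclic wiring has a topological ordering. -/
theorem exists_topOrder : Nonempty G.TopOrder := by
  classical
  let R : G.V → G.V → Prop := fun a b => ∃ e, (G.src e).1 = a ∧ (G.tgt e).1 = b
  have hpo : IsPartialOrder G.V (Relation.ReflTransGen R) :=
    { refl := fun _ => Relation.ReflTransGen.refl
      trans := fun _ _ _ => Relation.ReflTransGen.trans
      antisymm := fun a b hab hba => by
        by_contra hne
        rcases Relation.reflTransGen_iff_eq_or_transGen.1 hab with h | h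
        · exact hne h.symm
        · exact G.acyclic a (h.trans_left hba) }
  obtain ⟨s, hs, hrs⟩ := extend_partialOrder (Relation.ReflTransGen R)
  let L : LinearOrder G.V :=
    { le := s
      le_refl := hs.refl
      le_trans := hs.trans
      le_antisymm := hs.antisymm
      le_total := hs.total
      toDecidableLE := Classical.decRel _ }
  have := Fintype.ofFinite G.V
  let φ := Fintype.orderIsoFinOfCardEq G.V (Nat.card_eq_fintype_card (α := G.V)).symm
  refine ⟨φ.symm.toEquiv, fun e => ?_⟩
  have hle : (G.src e).1 ≤ (G.tgt e).1 := hrs _ _ (Relation.ReflTransGen.single ⟨e, rfl, rfl⟩)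
  have hne : (G.src e).1 ≠ (G.tgt e).1 := fun h =>
    G.acyclic (G.src e).1 (Relation.TransGen.single ⟨e, rfl, h.symm⟩)
  exact φ.symm.strictMono (lt_of_le_of_ne hle hne)

end Wiring

/-! ## KSC diagrams and their trace kernels -/

/-- Finite acyclic KSC diagrams in a Markov polycategory: vertices are labelled by morphisms, and
wires connect slots carrying the same object.  `dom` and `cod` are the external profiles. -/
structure KSCDiagram (P : MarkovPolycategory.{u, v}) extends Wiring.{u, w} P.Ob where
  label : ∀ a, P.Mor (inp a) (out a)
  wire_eq : ∀ e, toWiring.outOb (src e) = toWiring.inOb (tgt e)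
  dom : List P.Ob
  cod : List P.Ob
  dom_eq : dom = extIn.map toWiring.inOb
  cod_eq : cod = extOut.map toWiring.outOb

namespace KSCDiagram

variable {P : MarkovPolycategory.{u, v}} (D : KSCDiagram.{u, v, w} P)

/-- Values of all outputs of the first `n` vertices. -/
abbrev Hist (σ : D.TopOrder) (n : ℕ) : Type (max v w) :=
  ∀ a : {a : D.V // (σ.rank a : ℕ) < n}, Val P.U (D.out a)

open Classical in
/-- The position of an external input slot in the external input list. -/
noncomputable def extIdx {s : D.InSlot} (h : ¬ ∃ e, D.tgt e = s) : Fin D.dom.length :=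
  ⟨D.extIn.idxOf s, by
    have hs : s ∈ D.extIn := (D.mem_extIn s).2 fun e he => h ⟨e, he⟩
    simpa [D.dom_eq] using List.idxOf_lt_length_iff.2 hs⟩

theorem get_extIdx {s : D.InSlot} (h : ¬ ∃ e, D.tgt e = s) :
    D.dom.get (D.extIdx h) = D.inOb s := by
  have hs : s ∈ D.extIn := (D.mem_extIn s).2 fun e he => h ⟨e, he⟩
  simp [extIdx, D.dom_eq]

open Classical in
/-- The input tuple of the vertex `a` of rank `n`, from the external inputs and the outputs of the earlier
vertices: an input slot that is the target of a wire has the value at the source of that wire. -/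
noncomputable def inputVal (σ : D.TopOrder) {a : D.V} {n : ℕ} (hn : (σ.rank a : ℕ) = n)
    (p : Val P.U D.dom × D.Hist σ n) : Val P.U (D.inp a) := fun q =>
  if h : ∃ e, D.tgt e = ⟨a, q⟩ then
    castObj P.U
      (by rw [show D.outOb (D.src h.choose) = _ from D.wire_eq _, h.choose_spec]; rfl :
        D.outOb (D.src h.choose) = (D.inp a).get q)
      (p.2 ⟨(D.src h.choose).1, by
          have := σ.lt h.choose
          rw [h.choose_spec] at this
          exact hn ▸ this⟩ (D.src h.choose).2)
  else castObj P.U (D.get_extIdx h) (p.1 (D.extIdx h))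

theorem measurable_inputVal (σ : D.TopOrder) {a : D.V} {n : ℕ} (hn : (σ.rank a : ℕ) = n) :
    Measurable (D.inputVal σ hn) := by
  refine measurable_pi_lambda _ fun q => ?_
  by_cases h : ∃ e, D.tgt e = ⟨a, q⟩
  · simp only [inputVal, h, dite_true]
    exact (measurable_castObj _).comp ((measurable_pi_apply _).comp
      ((measurable_pi_apply _).comp measurable_snd))
  · simp only [inputVal, h, dite_false]
    exact (measurable_castObj _).comp ((measurable_pi_apply _).comp measurable_fst)

open Classical in
/-- Adding the outputs of the next vertex. -/
noncomputable def extend (σ : D.TopOrder) {a : D.V} {n : ℕ} (hn : (σ.rank a : ℕ) = n)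
    (p : D.Hist σ n × Val P.U (D.out a)) : D.Hist σ (n + 1) := fun a' =>
  if h : (σ.rank a' : ℕ) < n then p.1 ⟨a', h⟩
  else p.2.cast (by
    have h1 := a'.2
    have h2 : σ.rank a' = σ.rank a := Fin.ext (by omega)
    rw [σ.rank.injective h2])

theorem measurable_extend (σ : D.TopOrder) {a : D.V} {n : ℕ} (hn : (σ.rank a : ℕ) = n) :
    Measurable (D.extend σ hn) := by
  refine measurable_pi_lambda _ fun a' => ?_
  by_cases h : (σ.rank a' : ℕ) < n
  · simp only [extend, h, dite_true]
    exact (measurable_pi_apply _).comp measurable_fst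
  · simp only [extend, h, dite_false]
    exact (Val.measurable_cast _).comp measurable_snd

/-- One step of the evaluation: draw the outputs of the next vertex `a` from its label. -/
noncomputable def step (σ : D.TopOrder) {a : D.V} {n : ℕ} (hn : (σ.rank a : ℕ) = n)
    (K : Kernel (Val P.U D.dom) (D.Hist σ n)) : Kernel (Val P.U D.dom) (D.Hist σ (n + 1)) :=
  (K.compProd ((D.label a).ker.comap (D.inputVal σ hn) (D.measurable_inputVal σ hn))).map
    (D.extend σ hn)

/-- The conditional trace measure of the outputs of the first `n` vertices. -/
noncomputable def traceMeasure (σ : D.TopOrder) :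
    (n : ℕ) → n ≤ Nat.card D.V → Kernel (Val P.U D.dom) (D.Hist σ n)
  | 0, _ => Kernel.const _ (Measure.dirac fun a => absurd a.2 (Nat.not_lt_zero _))
  | n + 1, h =>
    D.step σ (a := σ.rank.symm ⟨n, h⟩) (by simp) (traceMeasure σ n (Nat.le_of_succ_le h))

/-- The external output tuple, from the outputs of all vertices. -/
noncomputable def readOut (σ : D.TopOrder) (y : D.Hist σ (Nat.card D.V)) : Val P.U D.cod := fun r =>
  let s : D.OutSlot := D.extOut.get ⟨r, by have := r.2; simpa [D.cod_eq] using this⟩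
  castObj P.U (by simp [s, D.cod_eq] : D.outOb s = D.cod.get r)
    (y ⟨s.1, (σ.rank s.1).2⟩ s.2)

/-- The trace kernel, evaluated along a topological ordering: internal wires are integrated out. -/
noncomputable def traceKernelAlong (σ : D.TopOrder) : Kernel (Val P.U D.dom) (Val P.U D.cod) :=
  (D.traceMeasure σ _ le_rfl).map (D.readOut σ)

/-- The trace kernel `K_D`, evaluated along some topological ordering. -/
noncomputable def traceKernel : Kernel (Val P.U D.dom) (Val P.U D.cod) :=
  D.traceKernelAlong D.exists_topOrder.some

end KSCDiagram

/-! ## CKSC diagrams, interface expansion, and trace kernels -/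

/-- Finite acyclic CKSC diagrams in a CMP: vertices are labelled by morphisms, and internal wires
carry admissible interface witnesses. -/
structure CKSCDiagram {S : ColorSystem.{x, y, z}} (P : CMP.{u, v} S) extends
    Wiring.{u, w} P.Ob where
  label : ∀ a, P.Mor (inp a) (out a)
  wit : ∀ e, P.Int (toWiring.outOb (src e)) (toWiring.inOb (tgt e))

namespace CKSCDiagram

variable {S : ColorSystem.{x, y, z}} {P : CMP.{u, v} S} (D : CKSCDiagram.{u, v, w} P)

/-- The external input profile. -/
abbrev dom : List P.Ob := D.extIn.map D.inOb

/-- The external output profile. -/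
abbrev cod : List P.Ob := D.extOut.map D.outOb

/-- Input profiles in the interface expansion, whose vertices are the vertices and wires of `D`. -/
abbrev expInp : D.V ⊕ D.W → List P.Ob
  | .inl a => D.inp a
  | .inr e => [D.outOb (D.src e)]

/-- Output profiles in the interface expansion. -/
abbrev expOut : D.V ⊕ D.W → List P.Ob
  | .inl a => D.out a
  | .inr e => [D.inOb (D.tgt e)]

/-- The input slots of `D` in the interface expansion. -/
def embIn (s : D.InSlot) : Σ a, Fin (D.expInp a).length := ⟨.inl s.1, s.2⟩

/-- The output slots of `D` in the interface expansion. -/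
def embOut (s : D.OutSlot) : Σ a, Fin (D.expOut a).length := ⟨.inl s.1, s.2⟩

/-- Sources of wires of the interface expansion: each wire `e` of `D` is replaced by a wire `inl e`
into its interface vertex and a wire `inr e` out of it. -/
def expSrc : D.W ⊕ D.W → Σ a, Fin (D.expOut a).length
  | .inl e => D.embOut (D.src e)
  | .inr e => ⟨.inr e, (0 : Fin 1)⟩

/-- Targets of wires of the interface expansion. -/
def expTgt : D.W ⊕ D.W → Σ a, Fin (D.expInp a).length
  | .inl e => ⟨.inr e, (0 : Fin 1)⟩
  | .inr e => D.embIn (D.tgt e)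

theorem embIn_injective : Function.Injective D.embIn := by
  rintro ⟨a, p⟩ ⟨b, q⟩ h
  simp only [embIn, Sigma.mk.injEq, Sum.inl.injEq] at h
  obtain ⟨rfl, h⟩ := h
  rw [eq_of_heq h]

theorem embOut_injective : Function.Injective D.embOut := by
  rintro ⟨a, p⟩ ⟨b, q⟩ h
  simp only [embOut, Sigma.mk.injEq, Sum.inl.injEq] at h
  obtain ⟨rfl, h⟩ := h
  rw [eq_of_heq h]

theorem expTgt_inr (e : D.W) : D.expTgt (.inr e) = D.embIn (D.tgt e) := rfl

theorem expSrc_inl (e : D.W) : D.expSrc (.inl e) = D.embOut (D.src e) := rfl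

theorem finite_W : Finite D.W := Finite.of_injective _ D.src_inj

theorem expSrc_injective : Function.Injective D.expSrc := by
  rintro (e | e) (e' | e') h
  · exact congrArg _ (D.src_inj (D.embOut_injective h))
  · exact absurd (congrArg Sigma.fst h) (by simp [expSrc, embOut])
  · exact absurd (congrArg Sigma.fst h) (by simp [expSrc, embOut])
  · simpa [expSrc] using congrArg Sigma.fst h

theorem expTgt_injective : Function.Injective D.expTgt := by
  rintro (e | e) (e' | e') h
  · simpa [expTgt] using congrArg Sigma.fst h
  · exact absurd (congrArg Sigma.fst h) (by simp [expTgt, embIn])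
  · exact absurd (congrArg Sigma.fst h) (by simp [expTgt, embIn])
  · exact congrArg _ (D.tgt_inj (D.embIn_injective h))

theorem exp_acyclic (a : D.V ⊕ D.W) : ¬ Relation.TransGen
    (fun a b => ∃ e, (D.expSrc e).1 = a ∧ (D.expTgt e).1 = b) a a := by
  obtain ⟨σ⟩ := D.exists_topOrder
  let r : D.V ⊕ D.W → ℕ := Sum.elim (fun a => 2 * σ.rank a) fun e => 2 * σ.rank (D.src e).1 + 1
  have hr : ∀ a b, Relation.TransGen
      (fun a b => ∃ e, (D.expSrc e).1 = a ∧ (D.expTgt e).1 = b) a b → r a < r b := by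
    intro a b h
    have key : ∀ e, r (D.expSrc e).1 < r (D.expTgt e).1 := by
      rintro (e | e)
      · simp [r, expSrc, expTgt, embOut]
      · have := σ.lt e
        simp only [r, expSrc, expTgt, embIn, Sum.elim_inl, Sum.elim_inr]
        omega
    induction h with
    | single h => obtain ⟨e, rfl, rfl⟩ := h; exact key e
    | tail _ h ih => obtain ⟨e, rfl, rfl⟩ := h; exact ih.trans (key e)
  exact fun h => lt_irrefl _ (hr a a h)

/-- The wiring of the interface expansion. -/
def expWiring : Wiring.{u, w} P.Ob where
  V := D.V ⊕ D.W
  fin := by have := D.finite_W; infer_instance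
  inp := D.expInp
  out := D.expOut
  W := D.W ⊕ D.W
  src := D.expSrc
  tgt := D.expTgt
  src_inj := D.expSrc_injective
  tgt_inj := D.expTgt_injective
  acyclic := D.exp_acyclic
  extIn := D.extIn.map D.embIn
  extIn_nodup := D.extIn_nodup.map D.embIn_injective
  mem_extIn := by
    rintro ⟨a | e, q⟩
    · have h : (⟨.inl a, q⟩ : Σ a, Fin (D.expInp a).length) = D.embIn ⟨a, q⟩ := rfl
      rw [h, List.mem_map_of_injective D.embIn_injective, D.mem_extIn]
      constructor
      · rintro h1 (e | e) h2
        · exact absurd (congrArg Sigma.fst h2) (by simp [expTgt, embIn])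
        · exact h1 e (D.embIn_injective h2)
      · exact fun h1 e h2 => h1 (.inr e) (congrArg D.embIn h2)
    · constructor
      · intro h
        obtain ⟨s, -, hs⟩ := List.mem_map.1 h
        exact absurd (congrArg Sigma.fst hs) (by simp [embIn])
      · intro h
        exact absurd (congrArg (Sigma.mk (Sum.inr e)) (Subsingleton.elim (α := Fin 1) 0 q)) (h (.inl e))
  extOut := D.extOut.map D.embOut
  extOut_nodup := D.extOut_nodup.map D.embOut_injective
  mem_extOut := by
    rintro ⟨a | e, q⟩
    · have h : (⟨.inl a, q⟩ : Σ a, Fin (D.expOut a).length) = D.embOut ⟨a, q⟩ := rfl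
      rw [h, List.mem_map_of_injective D.embOut_injective, D.mem_extOut]
      constructor
      · rintro h1 (e | e) h2
        · exact h1 e (D.embOut_injective h2)
        · exact absurd (congrArg Sigma.fst h2) (by simp [expSrc, embOut])
      · exact fun h1 e h2 => h1 (.inl e) (congrArg D.embOut h2)
    · constructor
      · intro h
        obtain ⟨s, -, hs⟩ := List.mem_map.1 h
        exact absurd (congrArg Sigma.fst hs) (by simp [embOut])
      · intro h
        exact absurd (congrArg (Sigma.mk (Sum.inr e)) (Subsingleton.elim (α := Fin 1) 0 q)) (h (.inr e))

/-- The interface expansion of `D`: every internal wire passes through a unary vertex labelled by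
the interface kernel of its witness. -/
noncomputable def expansion : KSCDiagram.{u, v, w} P.toMarkovPolycategory where
  toWiring := D.expWiring
  label
    | .inl a => D.label a
    | .inr e => P.κ (D.wit e)
  wire_eq
    | .inl _ => rfl
    | .inr _ => rfl
  dom := D.dom
  cod := D.cod
  dom_eq := (List.map_map (f := D.embIn) (g := fun s => D.expWiring.inOb s) (l := D.extIn)).symm
  cod_eq := (List.map_map (f := D.embOut) (g := fun s => D.expWiring.outOb s) (l := D.extOut)).symm

/-- The trace kernel `K_D`, that is, the trace kernel of the interface expansion. -/
noncomputable def traceKernel : Kernel (Val P.U D.dom) (Val P.U D.cod) := D.expansion.traceKernel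

/-! ## Iterated CKSC expressions -/

/-- Iterated CKSC expressions in the vertices and internal wires of `D`, with the ordered lists of
slots of `D` that their external inputs and outputs are.  `comp e E₁ E₂` stands for
`E₂ ∘^f_{(i,j)} E₁`, where `e` is an internal wire with witness `f` from the `i`-th external output
slot of `E₁` to the `j`-th external input slot of `E₂`. -/
inductive Expr : List D.InSlot → List D.OutSlot → Type (max u w)
  | vertex (a : D.V) : Expr (D.inSlots a) (D.outSlots a)
  | comp {I₁ I I₂ : List D.InSlot} {O₁ O O₂ : List D.OutSlot} (e : D.W)
      (E₁ : Expr I (O₁ ++ D.src e :: O₂)) (E₂ : Expr (I₁ ++ D.tgt e :: I₂) O) :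
      Expr (I₁ ++ I ++ I₂) (O₁ ++ O ++ O₂)

namespace Expr

variable {D}

/-- The vertices that occur in an expression. -/
def vertices : ∀ {I : List D.InSlot} {O : List D.OutSlot}, D.Expr I O → List D.V
  | _, _, .vertex a => [a]
  | _, _, .comp _ E₁ E₂ => E₁.vertices ++ E₂.vertices

/-- The internal wires that occur in an expression. -/
def wires : ∀ {I : List D.InSlot} {O : List D.OutSlot}, D.Expr I O → List D.W
  | _, _, .vertex _ => []
  | _, _, .comp e E₁ E₂ => e :: (E₁.wires ++ E₂.wires)

/-- Every vertex and every internal wire of `D` occurs exactly once in the expression. -/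
structure Realizes {I : List D.InSlot} {O : List D.OutSlot} (E : D.Expr I O) : Prop where
  vertices_nodup : E.vertices.Nodup
  mem_vertices : ∀ a, a ∈ E.vertices
  wires_nodup : E.wires.Nodup
  mem_wires : ∀ e, e ∈ E.wires

/-- The value of an expression: the morphism obtained by evaluating all CKSC operations. -/
noncomputable def value : ∀ {I : List D.InSlot} {O : List D.OutSlot}, D.Expr I O →
    P.Mor (I.map D.inOb) (O.map D.outOb)
  | _, _, .vertex a => (D.label a).cast (D.map_inSlots a).symm (D.map_outSlots a).symm
  | _, _, .comp (I₁ := I₁) (I₂ := I₂) (O₁ := O₁) (O₂ := O₂) e E₁ E₂ =>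
    P.cksc ⟨O₁.map D.outOb, O₂.map D.outOb, I₁.map D.inOb, I₂.map D.inOb,
        by simp, by simp, by simp, by simp⟩ (D.wit e) E₁.value E₂.value

end Expr

end CKSCDiagram

/-! Fix the external input `γ` and consider configurations `ω`, which assign values to all outputs
of all vertices of the interface expansion. Each vertex `a` acts on nonnegative observables by an
operator `resample γ a`: redraw the outputs of `a` from its label at the inputs read off `ω`, and
average. Composing these operators along a topological ordering computes integrals against the trace
kernel, the first vertex being the outermost integral (`lintegral_traceKernelAlong`). If no wire
joins `a` and `b`, neither kernel sees the other update, so by Tonelli the operators commute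
(`resample_comm`). Hence all enumerations without backward wires give the same composite
(`resampleList_perm`).

An expression determines such an enumeration: for `comp e E₁ E₂`, first that of `E₁`, then the
interface vertex of `e`, then that of `E₂`. Integrating against a CKSC means integrating
successively against `k`, the interface kernel and `l` (`lintegral_cksc`), so induction on the
expression shows that resampling along its enumeration computes its value (`resampleList_order`). If
every vertex and wire occurs exactly once, this is a linearization of the whole expansion, and the
value is the trace kernel along any topological ordering.

The algebraic laws follow directly from `lintegral_cksc`. In associativity both sides are the same
iterated integral. In the interchange laws they differ by swapping two independent two-stage
samplings. What remains is to compare tuples over profiles that are equal only propositionally, and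
this is done on lists of labelled entries, where transports disappear. -/

/-! ## Tuples as lists of labelled entries -/

namespace Val

variable {Ob : Type u} {U : Ob → Type v} {A B : List Ob} {a b : Ob}

/-- The list of the entries of a tuple, each with its object. -/
def toList (t : Val U A) : List (Σ X, U X) := List.ofFn fun r => ⟨A.get r, t r⟩

@[simp] theorem length_toList (t : Val U A) : t.toList.length = A.length := by simp [toList]

theorem sigma_castObj (h : a = b) (t : U a) :
    (⟨b, castObj U h t⟩ : Σ X, U X) = ⟨a, t⟩ := by
  subst h; rfl

/-- The objects in the list are dictated by the profile, so only the values carry information. Since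
transports do not change the list (`sigma_castObj`, `toList_cast`), identities between transported
tuples become identities between lists. -/
theorem toList_injective : Function.Injective (toList : Val U A → List (Σ X, U X)) := by
  intro s t h
  funext r
  have := congrFun (List.ofFn_injective h) r
  simpa using this

@[simp] theorem toList_cast (h : A = B) (t : Val U A) : (t.cast h).toList = t.toList := by
  subst h; rfl

theorem getElem_toList (t : Val U A) (r : ℕ) (h : r < t.toList.length) :
    t.toList[r] = ⟨A.get ⟨r, by simpa using h⟩, t ⟨r, by simpa using h⟩⟩ := by
  simp [toList]

@[simp] theorem toList_left (t : Val U (A ++ B)) : t.left.toList = t.toList.take A.length := by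
  refine List.ext_getElem (by simp) fun r h₁ h₂ => ?_
  simp only [List.getElem_take, getElem_toList, left]
  exact sigma_castObj _ _

@[simp] theorem toList_right (t : Val U (A ++ B)) : t.right.toList = t.toList.drop A.length := by
  refine List.ext_getElem (by simp) fun r h₁ h₂ => ?_
  simp only [List.getElem_drop, getElem_toList, right]
  exact sigma_castObj _ _

@[simp] theorem toList_append (s : Val U A) (t : Val U B) :
    (s.append t).toList = s.toList ++ t.toList := by
  refine List.ext_getElem (by simp) fun r h₁ h₂ => ?_
  simp only [List.getElem_append, getElem_toList, append, length_toList]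
  by_cases h : r < A.length
  · simp only [h, dite_true]
    exact sigma_castObj _ _
  · simp only [h, dite_false]
    exact sigma_castObj _ _

@[simp] theorem toList_single (t : U a) : (single t).toList = [⟨a, t⟩] := rfl

theorem toList_singleton (t : Val U [a]) : t.toList = [⟨a, t (0 : Fin 1)⟩] := rfl

@[simp] theorem toList_after (t : Val U (A ++ b :: B)) :
    t.after.toList = t.toList.drop (A.length + 1) := by
  refine List.ext_getElem (by simp; omega) fun r h₁ h₂ => ?_
  simp only [List.getElem_drop, getElem_toList, after]
  refine (sigma_castObj _ _).trans ?_
  congr! 3 <;> omega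

theorem getElem?_toList_slot (t : Val U (A ++ b :: B)) :
    t.toList[A.length]? = some ⟨b, t.slot⟩ := by
  rw [List.getElem?_eq_getElem (by simp), getElem_toList, slot]
  exact congrArg some (sigma_castObj _ _).symm

theorem toList_eq_append (t : Val U (A ++ B)) : t.toList = t.left.toList ++ t.right.toList := by
  simp

theorem toList_eq_slot (t : Val U (A ++ b :: B)) :
    t.toList = t.left.toList ++ ⟨b, t.slot⟩ :: t.after.toList := by
  have h : A.length < t.toList.length := by simp
  have h₁ := t.getElem?_toList_slot
  rw [List.getElem?_eq_getElem h, Option.some.injEq] at h₁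
  rw [toList_left, toList_after, ← h₁, ← List.drop_eq_getElem_cons h, List.take_append_drop]

end Val

namespace SlotPair

variable {Ob : Type u} {U : Ob → Type v} {A B C D Γ Δ : List Ob} {b c : Ob}

theorem toList_inK (s : SlotPair A B C D Γ Δ b c) (γ : Val U Γ) :
    (s.inK γ).toList = (γ.toList.drop s.C₁.length).take A.length := by
  simp [inK, List.drop_take]

theorem toList_inL (s : SlotPair A B C D Γ Δ b c) (γ : Val U Γ) (t : U c) :
    (s.inL γ t).toList =
      γ.toList.take s.C₁.length ++ ⟨c, t⟩ :: γ.toList.drop (s.C₁.length + A.length) := by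
  simp [inL, List.take_take]

theorem toList_outKL (s : SlotPair A B C D Γ Δ b c) (β : Val U B) (δ : Val U D) :
    (s.outKL β δ).toList =
      β.toList.take s.B₁.length ++ δ.toList ++ β.toList.drop (s.B₁.length + 1) := by
  simp [outKL]

theorem getElem?_toList_atSlot (s : SlotPair A B C D Γ Δ b c) (β : Val U B) :
    β.toList[s.B₁.length]? = some ⟨b, s.atSlot β⟩ := by
  rw [atSlot, ← Val.getElem?_toList_slot, Val.toList_cast]

/-- Only the lengths of the blocks matter, not how they are presented. In a nested composite the
blocks can therefore be regrouped freely, without computing with `take` and `drop`. -/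
theorem toList_inK_eq (s : SlotPair A B C D Γ Δ b c) {γ : Val U Γ} {L₁ L₂ L₃ : List (Σ X, U X)}
    (h : γ.toList = L₁ ++ L₂ ++ L₃) (h₁ : L₁.length = s.C₁.length) (h₂ : L₂.length = A.length) :
    (s.inK γ).toList = L₂ := by
  rw [toList_inK, h, ← h₁, ← h₂]; simp

theorem toList_inL_eq (s : SlotPair A B C D Γ Δ b c) {γ : Val U Γ} {L₁ L₂ L₃ : List (Σ X, U X)}
    (h : γ.toList = L₁ ++ L₂ ++ L₃) (h₁ : L₁.length = s.C₁.length) (h₂ : L₂.length = A.length)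
    (t : U c) : (s.inL γ t).toList = L₁ ++ ⟨c, t⟩ :: L₃ := by
  rw [toList_inL, h, ← h₁, ← h₂]
  simp [← List.drop_drop]

theorem toList_outKL_eq (s : SlotPair A B C D Γ Δ b c) {β : Val U B} {L₁ L₃ : List (Σ X, U X)}
    {t : Σ X, U X} (h : β.toList = L₁ ++ t :: L₃) (h₁ : L₁.length = s.B₁.length)
    (δ : Val U D) : (s.outKL β δ).toList = L₁ ++ δ.toList ++ L₃ := by
  rw [toList_outKL, h, ← h₁]
  simp [← List.drop_drop]

theorem atSlot_eq (s : SlotPair A B C D Γ Δ b c) {β : Val U B} {t : U b}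
    (h : β.toList[s.B₁.length]? = some ⟨b, t⟩) : s.atSlot β = t := by
  rw [s.getElem?_toList_atSlot β] at h
  simpa using h

theorem atSlot_eq_of_append (s : SlotPair A B C D Γ Δ b c) {β : Val U B}
    {L₁ L₃ : List (Σ X, U X)} {t : U b} (h : β.toList = L₁ ++ ⟨b, t⟩ :: L₃)
    (h₁ : L₁.length = s.B₁.length) : s.atSlot β = t :=
  s.atSlot_eq (by rw [h, ← h₁]; simp)

end SlotPair

/-! ## Integration against slotwise composites -/

section Integration

variable {X Y Z : Type*} [MeasurableSpace X] [MeasurableSpace Y] [MeasurableSpace Z]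

theorem measurable_lintegral_kernel {h : Z → X} (hh : Measurable h) (κ : Kernel X Y)
    [IsSFiniteKernel κ] {g : Z → Y → ENNReal} (hg : Measurable fun p : Z × Y => g p.1 p.2) :
    Measurable fun z => ∫⁻ y, g z y ∂κ (h z) :=
  Measurable.lintegral_kernel_prod_right' (κ := κ.comap h hh) hg

end Integration

section Ksc

variable {Ob : Type u} {U : Ob → Type v} [∀ X, MeasurableSpace (U X)]
  {A B C D Γ Δ : List Ob} {b : Ob}

theorem lintegral_kscKernel (s : SlotPair A B C D Γ Δ b b)
    (k : Kernel (Val U A) (Val U B)) [IsSFiniteKernel k]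
    (l : Kernel (Val U C) (Val U D)) [IsSFiniteKernel l]
    {g : Val U Δ → ENNReal} (hg : Measurable g) (γ : Val U Γ) :
    ∫⁻ o, g o ∂kscKernel s k l γ =
      ∫⁻ β, ∫⁻ δ, g (s.outKL β δ) ∂l (s.inL γ (s.atSlot β)) ∂k (s.inK γ) := by
  rw [kscKernel, Kernel.lintegral_map _ s.measurable_outKL _ hg,
    Kernel.lintegral_compProd (f := fun p => g (s.outKL p.1 p.2)) _ _ _
      (hg.comp s.measurable_outKL)]
  simp only [Kernel.comap_apply]

end Ksc

namespace CMP

variable {S : ColorSystem.{x, y, z}} (P : CMP.{u, v} S)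

open MarkovPolycategory

variable {A B C D Γ Δ : List P.Ob} {b c : P.Ob}

/-- Integrals of nonnegative measurable functions determine a kernel, so every law below becomes an
identity of iterated integrals. -/
theorem mor_ext {k l : P.Mor A B}
    (h : ∀ (γ : Val P.U A) (g : Val P.U B → ENNReal), Measurable g →
      ∫⁻ o, g o ∂k.ker γ = ∫⁻ o, g o ∂l.ker γ) : k = l :=
  Subtype.ext (Kernel.ext fun γ => Measure.ext_of_lintegral _ fun g hg => h γ g hg)

theorem lintegral_ksc (s : SlotPair A B C D Γ Δ b b) (k : P.Mor A B) (l : P.Mor C D)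
    {g : Val P.U Δ → ENNReal} (hg : Measurable g) (γ : Val P.U Γ) :
    ∫⁻ o, g o ∂(ksc s k l).ker γ =
      ∫⁻ β, ∫⁻ δ, g (s.outKL β δ) ∂l.ker (s.inL γ (s.atSlot β)) ∂k.ker (s.inK γ) :=
  lintegral_kscKernel s k.ker l.ker hg γ

/-- The integrand left after the integration over the outputs of the first factor of a CKSC. -/
noncomputable def ckscTail (s : SlotPair A B C D Γ Δ b c) (f : P.Int b c) (l : P.Mor C D)
    (g : Val P.U Δ → ENNReal) (γ : Val P.U Γ) (β : Val P.U B) : ENNReal :=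
  ∫⁻ τ, ∫⁻ δ, g (s.outKL β δ) ∂l.ker (s.inL γ (τ (0 : Fin 1)))
    ∂(P.κ f).ker (Val.single (s.atSlot β))

theorem measurable_ckscTail (s : SlotPair A B C D Γ Δ b c) (f : P.Int b c) (l : P.Mor C D)
    {g : Val P.U Δ → ENNReal} (hg : Measurable g) (γ : Val P.U Γ) :
    Measurable (P.ckscTail s f l g γ) := by
  refine measurable_lintegral_kernel
    (Val.measurable_single.comp s.measurable_atSlot) _ ?_
  refine measurable_lintegral_kernel
    (h := fun p : Val P.U B × Val P.U [c] => s.inL γ (p.2 (0 : Fin 1))) ?_ _ ?_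
  · exact s.measurable_inL.comp
      (measurable_const.prodMk ((measurable_pi_apply (0 : Fin 1)).comp measurable_snd))
  · exact hg.comp (s.measurable_outKL.comp
      ((measurable_fst.comp measurable_fst).prodMk measurable_snd))

/-- The two slotwise compositions in the definition pass through the profile `B₁ ++ c :: B₂`: the
interface value is put back into `β`, then read off and discarded. Removing this round trip leaves
three successive integrals, against `k`, the interface kernel and `l`. -/
theorem lintegral_cksc (s : SlotPair A B C D Γ Δ b c) (f : P.Int b c) (k : P.Mor A B)
    (l : P.Mor C D) {g : Val P.U Δ → ENNReal} (hg : Measurable g) (γ : Val P.U Γ) :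
    ∫⁻ o, g o ∂(P.cksc s f k l).ker γ =
      ∫⁻ β, P.ckscTail s f l g γ β ∂k.ker (s.inK γ) := by
  have hm : ∀ s' : SlotPair A (s.B₁ ++ c :: s.B₂) C D Γ Δ c c,
      Measurable fun ρ => ∫⁻ δ, g (s'.outKL ρ δ) ∂l.ker (s'.inL γ (s'.atSlot ρ)) := fun s' =>
    measurable_lintegral_kernel
      (s'.measurable_inL.comp (measurable_const.prodMk s'.measurable_atSlot)) _
      (hg.comp s'.measurable_outKL)
  rw [cksc, lintegral_ksc _ _ _ _ hg, lintegral_ksc _ _ _ _ (hm _)]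
  unfold ckscTail
  -- The slot lies inside `β`, so the prefix before it has its full length and the interface value
  -- sits exactly at position `|B₁|`.
  have hlen : ∀ β : Val P.U B, s.B₁.length < β.toList.length := fun β => by simp [s.hB]
  congr 1
  · congr 1
    apply Val.toList_injective
    simp only [SlotPair.toList_inK]
    simp [s.hΓ]
  · funext β
    congr 1
    · congr 1
      apply Val.toList_injective
      simp only [SlotPair.toList_inL, SlotPair.toList_inK]
      simp
      rfl
    · funext τ
      rw [SlotPair.atSlot_eq (t := τ (0 : Fin 1))]
      · congr 1
        funext δ
        congr 1
        apply Val.toList_injective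
        simp only [SlotPair.toList_outKL, Val.toList_singleton]
        have := (hlen β).le
        simp only [List.take_append, List.drop_append, List.take_take, List.drop_drop,
          List.length_take, List.length_append, List.length_singleton, min_eq_left this]
        simp
      · simp only [SlotPair.toList_outKL, Val.toList_singleton]
        have := hlen β
        rw [Val.length_toList] at this
        simp [min_eq_left this.le]

end CMP

/-- Two independent two-stage samplings can be performed in either order. -/
theorem lintegral_two_stage_swap {X Y X' Y' : Type*} [MeasurableSpace X] [MeasurableSpace Y]
    [MeasurableSpace X'] [MeasurableSpace Y'] (μ : Measure X) [SFinite μ] (μ' : Measure X')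
    [SFinite μ'] (η : Kernel X Y) [IsSFiniteKernel η] (η' : Kernel X' Y') [IsSFiniteKernel η']
    {G : X × Y → X' × Y' → ENNReal} (hG : Measurable fun p : (X × Y) × X' × Y' => G p.1 p.2) :
    ∫⁻ a, ∫⁻ c, ∫⁻ a', ∫⁻ c', G (a, c) (a', c') ∂η' a' ∂μ' ∂η a ∂μ =
      ∫⁻ a', ∫⁻ c', ∫⁻ a, ∫⁻ c, G (a, c) (a', c') ∂η a ∂μ ∂η' a' ∂μ' := by
  -- Each two-stage sampling is a single integral against a composition-product, so one application
  -- of Tonelli suffices.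
  have e₁ : ∀ p, ∫⁻ a', ∫⁻ c', G p (a', c') ∂η' a' ∂μ' = ∫⁻ q, G p q ∂(μ' ⊗ₘ η') := fun p =>
    (Measure.lintegral_compProd (hG.comp measurable_prodMk_left)).symm
  have e₂ : ∀ q, ∫⁻ a, ∫⁻ c, G (a, c) q ∂η a ∂μ = ∫⁻ p, G p q ∂(μ ⊗ₘ η) := fun q =>
    (Measure.lintegral_compProd (hG.comp measurable_prodMk_right)).symm
  simp only [e₁, e₂]
  rw [← Measure.lintegral_compProd hG.lintegral_prod_right',
    ← Measure.lintegral_compProd hG.lintegral_prod_left']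
  exact lintegral_lintegral_swap hG.aemeasurable

/-! ### Associativity of CKSC -/

namespace CMP

variable {S : ColorSystem.{x, y, z}} (P : CMP.{u, v} S)

open MarkovPolycategory

/-- Both sides integrate against `k`, `κ f`, `l`, `κ g`, `m` in this order, so no exchange of
integrals is needed. It remains to see that the kernels are evaluated at the same tuples and that
the same output tuple is assembled. -/
theorem cksc_associative : P.CKSCAssociative := by
  intro A B₁ B₂ C₁ C₂ D₁ D₂ E₁ E₂ F b c d e f g k l m
  refine P.mor_ext fun γ G hG => ?_
  rw [lintegral_cksc _ _ _ _ _ hG, lintegral_cksc _ _ _ _ _ (measurable_ckscTail _ _ _ _ hG _),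
    lintegral_cksc _ _ _ _ _ hG]
  obtain ⟨γ₁, γ₂, γ₃, γ₄, γ₅, hγ⟩ : ∃ (γ₁ : Val P.U E₁) (γ₂ : Val P.U C₁) (γ₃ : Val P.U A)
      (γ₄ : Val P.U C₂) (γ₅ : Val P.U E₂),
      γ.toList = γ₁.toList ++ γ₂.toList ++ γ₃.toList ++ γ₄.toList ++ γ₅.toList :=
    ⟨γ.left.left.left.left, γ.left.left.left.right, γ.left.left.right, γ.left.right, γ.right,
      by simp only [← Val.toList_eq_append]⟩
  -- These facts are stated for any slot pair with the given position, so that they apply to the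
  -- anonymous ones in the goal.
  have hK : ∀ {B D Δ : List P.Ob} {d e : P.Ob} (s : SlotPair (C₁ ++ A ++ C₂) B (E₁ ++ e :: E₂) D
      (E₁ ++ C₁ ++ A ++ C₂ ++ E₂) Δ d e), s.C₁ = E₁ →
      (s.inK γ).toList = γ₂.toList ++ γ₃.toList ++ γ₄.toList := fun s hs =>
    s.toList_inK_eq (L₁ := γ₁.toList) (L₃ := γ₅.toList) (by simp [hγ]) (by simp [hs]) (by simp)
  have hL : ∀ {B C D Δ : List P.Ob} {b : P.Ob} (s : SlotPair A B C D
      (E₁ ++ C₁ ++ A ++ C₂ ++ E₂) Δ b c) (t : P.U c), s.C₁ = E₁ ++ C₁ →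
      (s.inL γ t).toList = γ₁.toList ++ (γ₂.toList ++ ⟨c, t⟩ :: γ₄.toList) ++ γ₅.toList := by
    intro _ _ _ _ _ s t hs
    rw [s.toList_inL_eq (L₁ := γ₁.toList ++ γ₂.toList) (L₂ := γ₃.toList)
      (L₃ := γ₄.toList ++ γ₅.toList) (by simp [hγ]) (by simp [hs]) (by simp)]
    simp
  congr 1
  · congr 1
    apply Val.toList_injective
    rw [SlotPair.toList_inK_eq (L₁ := γ₂.toList) (L₂ := γ₃.toList) (L₃ := γ₄.toList),
      SlotPair.toList_inK_eq (L₁ := γ₁.toList ++ γ₂.toList) (L₂ := γ₃.toList)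
        (L₃ := γ₄.toList ++ γ₅.toList)]
    all_goals simp [hγ, hK]
  funext β
  have hβ := β.toList_eq_slot
  generalize β.left = β₁, β.slot = β₂, β.after = β₃ at hβ
  simp only [ckscTail]
  congr 1
  funext τ
  rw [lintegral_cksc]
  swap
  · exact hG.comp ((SlotPair.measurable_outKL _).comp measurable_prodMk_left)
  simp only [ckscTail]
  congr 1
  · congr 1
    apply Val.toList_injective
    rw [SlotPair.toList_inL_eq (L₁ := γ₂.toList) (L₂ := γ₃.toList) (L₃ := γ₄.toList),
      SlotPair.toList_inK_eq (L₁ := γ₁.toList) (L₃ := γ₅.toList)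
        (L₂ := γ₂.toList ++ ⟨c, τ (0 : Fin 1)⟩ :: γ₄.toList)]
    all_goals simp [hK, hL]
  funext δ
  have hδ := δ.toList_eq_slot
  generalize δ.left = δ₁, δ.slot = δ₂, δ.after = δ₃ at hδ
  have hO : ∀ {C Γ Δ : List P.Ob} (s : SlotPair A (B₁ ++ b :: B₂) C (D₁ ++ d :: D₂) Γ Δ b c),
      s.B₁ = B₁ → (s.outKL β δ).toList =
        (β₁.toList ++ δ₁.toList) ++ ⟨d, δ₂⟩ :: (δ₃.toList ++ β₃.toList) := by
    intro _ _ _ s hs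
    rw [s.toList_outKL_eq hβ (by simp [hs]), hδ]
    simp
  congr 1
  · congr 2
    rw [SlotPair.atSlot_eq_of_append _ (hO _ _), SlotPair.atSlot_eq_of_append _ hδ]
    all_goals simp
  funext τ'
  congr 1
  · congr 1
    apply Val.toList_injective
    rw [SlotPair.toList_inL_eq (L₁ := γ₁.toList) (L₃ := γ₅.toList)
        (L₂ := γ₂.toList ++ γ₃.toList ++ γ₄.toList),
      SlotPair.toList_inL_eq (L₁ := γ₁.toList) (L₃ := γ₅.toList)
        (L₂ := γ₂.toList ++ ⟨c, τ (0 : Fin 1)⟩ :: γ₄.toList)]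
    all_goals simp [hγ, hL]
  funext φ
  congr 1
  apply Val.toList_injective
  rw [SlotPair.toList_outKL_eq _ (hO _ _), SlotPair.toList_outKL_eq _ hβ,
    SlotPair.toList_outKL_eq _ hδ]
  all_goals simp

end CMP

/-! ### Interchange laws for CKSC -/

theorem List.append_comm_of_eq_nil {α : Type*} {l l' : List α} (h : l = [] ∨ l' = []) :
    l ++ l' = l' ++ l := by
  rcases h with rfl | rfl <;> simp

theorem Val.toList_append_comm {Ob : Type u} {U : Ob → Type v} {A B : List Ob} (s : Val U A)
    (t : Val U B) (h : A = [] ∨ B = []) : s.toList ++ t.toList = t.toList ++ s.toList := by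
  refine List.append_comm_of_eq_nil ?_
  rcases h with rfl | rfl
  · exact .inl rfl
  · exact .inr rfl

namespace CMP

variable {S : ColorSystem.{x, y, z}} (P : CMP.{u, v} S)

open MarkovPolycategory

/-- Once `β` is drawn from `k`, the branches `κ f`, `l` and `κ f'`, `l'` are independent two-stage
samplings, and Tonelli exchanges them. The hypotheses isolate the bookkeeping of slots from this
argument. -/
theorem cksc_comm_of_outputs {A A₁ A₂ B B₁ B₂ C D C' D' Γ Δ : List P.Ob} {b c b' c' : P.Ob}
    (s₁ : SlotPair A₁ B₁ C' D' Γ Δ b' c') (s₂ : SlotPair A B C D A₁ B₁ b c)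
    (s₃ : SlotPair A₂ B₂ C D Γ Δ b c) (s₄ : SlotPair A B C' D' A₂ B₂ b' c')
    (hK : ∀ γ : Val P.U Γ, s₂.inK (s₁.inK γ) = s₄.inK (s₃.inK γ))
    (hL : ∀ (γ : Val P.U Γ) t, s₂.inL (s₁.inK γ) t = s₃.inL γ t)
    (hL' : ∀ (γ : Val P.U Γ) t, s₄.inL (s₃.inK γ) t = s₁.inL γ t)
    (hs : ∀ (β : Val P.U B) (δ : Val P.U D), s₁.atSlot (s₂.outKL β δ) = s₄.atSlot β)
    (hs' : ∀ (β : Val P.U B) (δ : Val P.U D'), s₃.atSlot (s₄.outKL β δ) = s₂.atSlot β)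
    (hO : ∀ (β : Val P.U B) (δ : Val P.U D) (δ' : Val P.U D'),
      s₁.outKL (s₂.outKL β δ) δ' = s₃.outKL (s₄.outKL β δ') δ)
    (f : P.Int b c) (f' : P.Int b' c') (k : P.Mor A B) (l : P.Mor C D) (l' : P.Mor C' D') :
    P.cksc s₁ f' (P.cksc s₂ f k l) l' = P.cksc s₃ f (P.cksc s₄ f' k l') l := by
  refine P.mor_ext fun γ G hG => ?_
  rw [lintegral_cksc _ _ _ _ _ hG, lintegral_cksc _ _ _ _ _ (measurable_ckscTail _ _ _ _ hG _),
    lintegral_cksc _ _ _ _ _ hG, lintegral_cksc _ _ _ _ _ (measurable_ckscTail _ _ _ _ hG _)]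
  simp only [ckscTail, hK, hL, hL', hs, hs', ← hO]
  congr 1
  funext β
  exact lintegral_two_stage_swap _ _
    (l.ker.comap (fun τ : Val P.U [c] => s₃.inL γ (τ (0 : Fin 1)))
      (s₃.measurable_inL.comp
        (measurable_const.prodMk (measurable_pi_apply (0 : Fin 1)))))
    (l'.ker.comap (fun τ : Val P.U [c'] => s₁.inL γ (τ (0 : Fin 1)))
      (s₁.measurable_inL.comp
        (measurable_const.prodMk (measurable_pi_apply (0 : Fin 1)))))
    (G := fun p q => G (s₁.outKL (s₂.outKL β p.2) q.2))
    (hG.comp (s₁.measurable_outKL.comp ((s₂.measurable_outKL.comp (measurable_const.prodMk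
      (measurable_snd.comp measurable_fst))).prodMk (measurable_snd.comp measurable_snd))))

/-- Here the independent samplings are `k'`, `κ f'` and `k`, `κ f`; the integral against `l` is
their common integrand. -/
theorem cksc_comm_of_inputs {A B A' B' C C₁ C₂ D D₁ D₂ Γ Δ : List P.Ob} {b c b' c' : P.Ob}
    (s₁ : SlotPair A' B' C₁ D₁ Γ Δ b' c') (s₂ : SlotPair A B C D C₁ D₁ b c)
    (s₃ : SlotPair A B C₂ D₂ Γ Δ b c) (s₄ : SlotPair A' B' C D C₂ D₂ b' c')
    (hK : ∀ (γ : Val P.U Γ) t, s₂.inK (s₁.inL γ t) = s₃.inK γ)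
    (hK' : ∀ (γ : Val P.U Γ) t, s₄.inK (s₃.inL γ t) = s₁.inK γ)
    (hL : ∀ (γ : Val P.U Γ) t t', s₂.inL (s₁.inL γ t') t = s₄.inL (s₃.inL γ t) t')
    (hs : ∀ β : Val P.U B, s₂.atSlot β = s₃.atSlot β)
    (hs' : ∀ β : Val P.U B', s₁.atSlot β = s₄.atSlot β)
    (hO : ∀ (β : Val P.U B) (β' : Val P.U B') (δ : Val P.U D),
      s₁.outKL β' (s₂.outKL β δ) = s₃.outKL β (s₄.outKL β' δ))
    (f : P.Int b c) (f' : P.Int b' c') (k : P.Mor A B) (k' : P.Mor A' B') (l : P.Mor C D) :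
    P.cksc s₁ f' k' (P.cksc s₂ f k l) = P.cksc s₃ f k (P.cksc s₄ f' k' l) := by
  refine P.mor_ext fun γ G hG => ?_
  rw [lintegral_cksc _ _ _ _ _ hG, lintegral_cksc _ _ _ _ _ hG]
  have e₁ : ∀ t β', ∫⁻ δ, G (s₁.outKL β' δ) ∂(P.cksc s₂ f k l).ker (s₁.inL γ t) = _ := fun t β' =>
    P.lintegral_cksc s₂ f k l (hG.comp (s₁.measurable_outKL.comp measurable_prodMk_left)) _
  have e₂ : ∀ t β, ∫⁻ δ, G (s₃.outKL β δ) ∂(P.cksc s₄ f' k' l).ker (s₃.inL γ t) = _ := fun t β =>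
    P.lintegral_cksc s₄ f' k' l (hG.comp (s₃.measurable_outKL.comp measurable_prodMk_left)) _
  simp only [ckscTail, e₁, e₂, hK, hK', hL, hs, hs', Function.comp_apply, hO]
  refine (lintegral_two_stage_swap (k'.ker (s₁.inK γ)) (k.ker (s₃.inK γ))
    ((P.κ f').ker.comap _ (Val.measurable_single.comp s₄.measurable_atSlot))
    ((P.κ f).ker.comap _ (Val.measurable_single.comp s₃.measurable_atSlot))
    (G := fun p q => ∫⁻ δ, G (s₃.outKL q.1 (s₄.outKL p.1 δ))
      ∂l.ker (s₄.inL (s₃.inL γ (q.2 (0 : Fin 1))) (p.2 (0 : Fin 1)))) ?_)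
  refine measurable_lintegral_kernel (h := fun p : (Val P.U B' × Val P.U [c']) ×
    Val P.U B × Val P.U [c] => s₄.inL (s₃.inL γ (p.2.2 (0 : Fin 1))) (p.1.2 (0 : Fin 1))) ?_ _ ?_
  · exact s₄.measurable_inL.comp ((s₃.measurable_inL.comp (measurable_const.prodMk
      ((measurable_pi_apply (0 : Fin 1)).comp (measurable_snd.comp measurable_snd)))).prodMk
      ((measurable_pi_apply (0 : Fin 1)).comp (measurable_snd.comp measurable_fst)))
  · exact hG.comp (s₃.measurable_outKL.comp
      (((measurable_fst.comp measurable_snd).comp measurable_fst).prodMk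
        (s₄.measurable_outKL.comp
          (((measurable_fst.comp measurable_fst).comp measurable_fst).prodMk measurable_snd))))

theorem cksc_interchange_out : P.CKSCInterchangeOut := by
  intro A B₁ B₂ B₃ C₁ C₂ D C₁' C₂' D' b c b' c' h₁ h₂ f f' k l l'
  -- Two groupings of the inputs, one for each nesting. The second exists because one of `C₁`, `C₁'`
  -- and one of `C₂`, `C₂'` is empty, so the corresponding blocks commute.
  have hγ : ∀ γ : Val P.U (C₁' ++ C₁ ++ A ++ C₂ ++ C₂'), ∃ (γ₁' : Val P.U C₁') (γ₁ : Val P.U C₁)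
      (γ₃ : Val P.U A) (γ₂ : Val P.U C₂) (γ₂' : Val P.U C₂'),
      γ.toList = γ₁'.toList ++ (γ₁.toList ++ γ₃.toList ++ γ₂.toList) ++ γ₂'.toList ∧
      γ.toList = γ₁.toList ++ (γ₁'.toList ++ γ₃.toList ++ γ₂'.toList) ++ γ₂.toList := by
    intro γ
    have h := γ.toList_eq_append
    rw [γ.left.toList_eq_append, γ.left.left.toList_eq_append,
      γ.left.left.left.toList_eq_append] at h
    refine ⟨γ.left.left.left.left, γ.left.left.left.right, γ.left.left.right, γ.left.right, γ.right,
      h.trans (by simp only [List.append_assoc]), h.trans ?_⟩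
    rw [← Val.toList_append_comm _ _ h₁, List.append_assoc _ (Val.toList _) (Val.toList _),
      Val.toList_append_comm _ _ h₂]
    simp only [List.append_assoc]
  have hβ : ∀ β : Val P.U (B₁ ++ b :: B₂ ++ b' :: B₃), ∃ (β₁ : Val P.U B₁) (t : P.U b)
      (β₂ : Val P.U B₂) (t' : P.U b') (β₃ : Val P.U B₃),
      β.toList = β₁.toList ++ ⟨b, t⟩ :: β₂.toList ++ ⟨b', t'⟩ :: β₃.toList ∧
      β.toList = β₁.toList ++ ⟨b, t⟩ :: (β₂.toList ++ ⟨b', t'⟩ :: β₃.toList) := by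
    intro β
    have h := β.toList_eq_slot
    rw [β.left.toList_eq_slot] at h
    exact ⟨_, _, _, _, _, h, h.trans (by simp only [List.append_assoc, List.cons_append])⟩
  refine P.cksc_comm_of_outputs _ _ _ _ ?_ ?_ ?_ ?_ ?_ ?_ f f' k l l'
  · intro γ
    obtain ⟨γ₁', γ₁, γ₃, γ₂, γ₂', hγ, hγ'⟩ := hγ γ
    apply Val.toList_injective
    rw [SlotPair.toList_inK_eq _ (SlotPair.toList_inK_eq _ hγ _ _),
      SlotPair.toList_inK_eq _ (SlotPair.toList_inK_eq _ hγ' _ _)]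
    all_goals simp
  · intro γ t
    obtain ⟨γ₁', γ₁, γ₃, γ₂, γ₂', hγ, hγ'⟩ := hγ γ
    apply Val.toList_injective
    rw [SlotPair.toList_inL_eq _ (SlotPair.toList_inK_eq _ hγ _ _),
      SlotPair.toList_inL_eq _ hγ']
    all_goals simp
  · intro γ t
    obtain ⟨γ₁', γ₁, γ₃, γ₂, γ₂', hγ, hγ'⟩ := hγ γ
    apply Val.toList_injective
    rw [SlotPair.toList_inL_eq _ (SlotPair.toList_inK_eq _ hγ' _ _),
      SlotPair.toList_inL_eq _ hγ]
    all_goals simp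
  · intro β δ
    obtain ⟨β₁, t, β₂, t', β₃, hβ, hβ'⟩ := hβ β
    rw [SlotPair.atSlot_eq_of_append (L₁ := β₁.toList ++ δ.toList ++ β₂.toList) (t := t')
        (L₃ := β₃.toList) _ (by rw [SlotPair.toList_outKL_eq _ hβ' (by simp)]; simp),
      SlotPair.atSlot_eq_of_append _ hβ]
    all_goals simp
  · intro β δ
    obtain ⟨β₁, t, β₂, t', β₃, hβ, hβ'⟩ := hβ β
    rw [SlotPair.atSlot_eq_of_append (L₁ := β₁.toList) (t := t)
        (L₃ := β₂.toList ++ δ.toList ++ β₃.toList) _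
        (by rw [SlotPair.toList_outKL_eq _ hβ (by simp)]; simp),
      SlotPair.atSlot_eq_of_append _ hβ']
    all_goals simp
  · intro β δ δ'
    obtain ⟨β₁, t, β₂, t', β₃, hβ, hβ'⟩ := hβ β
    apply Val.toList_injective
    rw [SlotPair.toList_outKL_eq (L₁ := β₁.toList ++ δ.toList ++ β₂.toList) (t := ⟨b', t'⟩)
        (L₃ := β₃.toList) _ (by rw [SlotPair.toList_outKL_eq _ hβ' (by simp)]; simp),
      SlotPair.toList_outKL_eq (L₁ := β₁.toList) (t := ⟨b, t⟩)
        (L₃ := β₂.toList ++ δ'.toList ++ β₃.toList) _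
        (by rw [SlotPair.toList_outKL_eq _ hβ (by simp)]; simp)]
    all_goals simp

theorem cksc_interchange_in : P.CKSCInterchangeIn := by
  intro A B₁ B₂ A' B₁' B₂' C₁ C₂ C₃ D b c b' c' h₁ h₂ f f' k k' l
  have hγ : ∀ γ : Val P.U (C₁ ++ A ++ C₂ ++ A' ++ C₃), ∃ (γ₁ : Val P.U C₁) (α : Val P.U A)
      (γ₂ : Val P.U C₂) (α' : Val P.U A') (γ₃ : Val P.U C₃),
      γ.toList = γ₁.toList ++ α.toList ++ (γ₂.toList ++ α'.toList ++ γ₃.toList) ∧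
      γ.toList = (γ₁.toList ++ α.toList ++ γ₂.toList) ++ α'.toList ++ γ₃.toList := by
    intro γ
    have h := γ.toList_eq_append
    rw [γ.left.toList_eq_append, γ.left.left.toList_eq_append,
      γ.left.left.left.toList_eq_append] at h
    exact ⟨_, _, _, _, _, h.trans (by simp only [List.append_assoc]), h⟩
  refine P.cksc_comm_of_inputs _ _ _ _ ?_ ?_ ?_ ?_ ?_ ?_ f f' k k' l
  · intro γ t
    obtain ⟨γ₁, α, γ₂, α', γ₃, hγ, hγ'⟩ := hγ γ
    apply Val.toList_injective
    rw [SlotPair.toList_inK_eq (L₁ := γ₁.toList) (L₂ := α.toList)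
        (L₃ := γ₂.toList ++ ⟨c', t⟩ :: γ₃.toList) _
        (by rw [SlotPair.toList_inL_eq _ hγ' (by simp) (by simp)]; simp),
      SlotPair.toList_inK_eq _ hγ]
    all_goals simp
  · intro γ t
    obtain ⟨γ₁, α, γ₂, α', γ₃, hγ, hγ'⟩ := hγ γ
    apply Val.toList_injective
    rw [SlotPair.toList_inK_eq (L₁ := γ₁.toList ++ ⟨c, t⟩ :: γ₂.toList) (L₂ := α'.toList)
        (L₃ := γ₃.toList) _
        (by rw [SlotPair.toList_inL_eq _ hγ (by simp) (by simp)]; simp),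
      SlotPair.toList_inK_eq _ hγ']
    all_goals simp
  · intro γ t t'
    obtain ⟨γ₁, α, γ₂, α', γ₃, hγ, hγ'⟩ := hγ γ
    apply Val.toList_injective
    rw [SlotPair.toList_inL_eq (L₁ := γ₁.toList) (L₂ := α.toList)
        (L₃ := γ₂.toList ++ ⟨c', t'⟩ :: γ₃.toList) _
        (by rw [SlotPair.toList_inL_eq _ hγ' (by simp) (by simp)]; simp),
      SlotPair.toList_inL_eq (L₁ := γ₁.toList ++ ⟨c, t⟩ :: γ₂.toList) (L₂ := α'.toList)
        (L₃ := γ₃.toList) _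
        (by rw [SlotPair.toList_inL_eq _ hγ (by simp) (by simp)]; simp)]
    all_goals simp
  · exact fun _ => rfl
  · exact fun _ => rfl
  · intro β β' δ
    have hβ := β.toList_eq_slot
    have hβ' := β'.toList_eq_slot
    generalize β.left = β₁, β.slot = t, β.after = β₂ at hβ
    generalize β'.left = β₁', β'.slot = t', β'.after = β₂' at hβ'
    apply Val.toList_injective
    -- The output lists differ by exchanging the blocks `β₁`, `β₁'` and the blocks `β₂`, `β₂'`; in
    -- each pair one block is empty.
    rw [SlotPair.toList_outKL_eq _ hβ', SlotPair.toList_outKL_eq _ hβ,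
      SlotPair.toList_outKL_eq _ hβ, SlotPair.toList_outKL_eq _ hβ', List.append_assoc,
      List.append_assoc, Val.toList_append_comm _ _ h₂]
    · simp only [← List.append_assoc]
      rw [Val.toList_append_comm _ _ h₁]
    all_goals simp

end CMP

/-! ### Resampling operators on configurations -/

namespace KSCDiagram

variable {P : MarkovPolycategory.{u, v}} (D : KSCDiagram.{u, v, w} P)

/-- Values of all outputs of all vertices. -/
abbrev Config : Type (max v w) := ∀ a : D.V, Val P.U (D.out a)

open Classical in
/-- The value in an input slot: the value at the source of the wire into it, or the external
input. -/
noncomputable def slotIn (γ : Val P.U D.dom) (ω : D.Config) (s : D.InSlot) : P.U (D.inOb s) :=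
  if h : ∃ e, D.tgt e = s then
    castObj P.U (a := D.outOb (D.src h.choose))
      (by rw [show D.outOb (D.src h.choose) = _ from D.wire_eq _, h.choose_spec])
      (ω (D.src h.choose).1 (D.src h.choose).2)
  else castObj P.U (D.get_extIdx h) (γ (D.extIdx h))

theorem slotIn_of_tgt (γ : Val P.U D.dom) (ω : D.Config) {s : D.InSlot} {e : D.W}
    (h : D.tgt e = s) :
    (⟨D.inOb s, D.slotIn γ ω s⟩ : Σ X, P.U X) = ⟨D.outOb (D.src e), ω (D.src e).1 (D.src e).2⟩ := by
  have h' : ∃ e, D.tgt e = s := ⟨e, h⟩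
  -- Linearity of the wiring: the wire chosen in `slotIn` is the only one into `s`.
  have he : h'.choose = e := D.tgt_inj (h'.choose_spec.trans h.symm)
  rw [slotIn, dif_pos h', ← he]
  exact Val.sigma_castObj _ _

theorem slotIn_extIn (γ : Val P.U D.dom) (ω : D.Config) {r : ℕ} (hr : r < D.extIn.length) :
    (⟨D.inOb D.extIn[r], D.slotIn γ ω D.extIn[r]⟩ : Σ X, P.U X) =
      ⟨D.dom.get ⟨r, by simpa [D.dom_eq] using hr⟩, γ ⟨r, by simpa [D.dom_eq] using hr⟩⟩ := by
  have h : ¬ ∃ e, D.tgt e = D.extIn[r] := fun ⟨e, he⟩ =>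
    (D.mem_extIn _).1 (List.getElem_mem hr) e he
  have hidx : D.extIdx h = ⟨r, by simpa [D.dom_eq] using hr⟩ := by
    classical
    refine Fin.ext ?_
    unfold extIdx
    convert D.extIn_nodup.idxOf_getElem r hr
  rw [slotIn, dif_neg h, Val.sigma_castObj, hidx]

theorem slotIn_congr (γ : Val P.U D.dom) {ω ω' : D.Config} {s : D.InSlot}
    (h : ∀ e, D.tgt e = s → ω (D.src e).1 = ω' (D.src e).1) :
    D.slotIn γ ω s = D.slotIn γ ω' s := by
  by_cases hs : ∃ e, D.tgt e = s
  · simp only [slotIn, hs, dite_true]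
    rw [h _ hs.choose_spec]
  · simp only [slotIn, hs, dite_false]

theorem measurable_slotIn (γ : Val P.U D.dom) (s : D.InSlot) :
    Measurable fun ω => D.slotIn γ ω s := by
  by_cases hs : ∃ e, D.tgt e = s
  · simp only [slotIn, hs, dite_true]
    exact (measurable_castObj _).comp ((measurable_pi_apply _).comp (measurable_pi_apply _))
  · simp only [slotIn, hs, dite_false]
    exact measurable_const

/-- The input tuple of a vertex. -/
noncomputable def vertexIn (γ : Val P.U D.dom) (ω : D.Config) (a : D.V) : Val P.U (D.inp a) :=
  fun q => D.slotIn γ ω ⟨a, q⟩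

theorem measurable_vertexIn (γ : Val P.U D.dom) (a : D.V) :
    Measurable fun ω => D.vertexIn γ ω a :=
  measurable_pi_lambda _ fun q => D.measurable_slotIn γ ⟨a, q⟩

/-- There is a wire from the first vertex to the second. -/
def Precedes (a b : D.V) : Prop := ∃ e, (D.src e).1 = a ∧ (D.tgt e).1 = b

open Classical in
theorem vertexIn_update (γ : Val P.U D.dom) (ω : D.Config) {a b : D.V} (h : ¬ D.Precedes a b)
    (β : Val P.U (D.out a)) :
    D.vertexIn γ (Function.update ω a β) b = D.vertexIn γ ω b := by
  funext q
  refine D.slotIn_congr γ fun e he => Function.update_of_ne (fun h' => h ⟨e, h', ?_⟩) _ _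
  rw [he]

open Classical in
/-- Resampling the outputs of a vertex, as an operation on observables. -/
noncomputable def resample (γ : Val P.U D.dom) (a : D.V) (g : D.Config → ENNReal) (ω : D.Config) :
    ENNReal :=
  ∫⁻ β, g (Function.update ω a β) ∂(D.label a).ker (D.vertexIn γ ω a)

theorem measurable_resample (γ : Val P.U D.dom) (a : D.V) {g : D.Config → ENNReal}
    (hg : Measurable g) : Measurable (D.resample γ a g) := by
  classical
  exact measurable_lintegral_kernel (D.measurable_vertexIn γ a) _ (hg.comp measurable_update')

/-- Neither kernel depends on the coordinate that the other redraws, and updates at distinct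
vertices commute, so Tonelli applies. -/
theorem resample_comm (γ : Val P.U D.dom) {a b : D.V} (hab : ¬ D.Precedes a b)
    (hba : ¬ D.Precedes b a) {g : D.Config → ENNReal} (hg : Measurable g) :
    D.resample γ a (D.resample γ b g) = D.resample γ b (D.resample γ a g) := by
  classical
  rcases eq_or_ne a b with rfl | hne
  · rfl
  funext ω
  simp only [resample, D.vertexIn_update γ ω hab, D.vertexIn_update γ ω hba]
  rw [lintegral_lintegral_swap]
  · simp only [Function.update_comm hne]
  · refine (hg.comp ?_).aemeasurable
    exact measurable_update'.comp ((measurable_update'.comp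
      (measurable_const.prodMk measurable_fst)).prodMk measurable_snd)

/-- Resampling the outputs of the vertices of a list, one after the other. -/
noncomputable def resampleList (γ : Val P.U D.dom) (L : List D.V) (g : D.Config → ENNReal) :
    D.Config → ENNReal := L.foldr (D.resample γ) g

theorem resampleList_append (γ : Val P.U D.dom) (L L' : List D.V) (g : D.Config → ENNReal) :
    D.resampleList γ (L ++ L') g = D.resampleList γ L (D.resampleList γ L' g) :=
  List.foldr_append

theorem measurable_resampleList (γ : Val P.U D.dom) (L : List D.V) {g : D.Config → ENNReal}
    (hg : Measurable g) : Measurable (D.resampleList γ L g) := by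
  induction L with
  | nil => exact hg
  | cons a L ih => exact D.measurable_resample γ a ih

/-- Resampling along `L` changes only coordinates in `L`. It thus permits freezing, inside an
observable, everything that depends on other coordinates. -/
theorem resampleList_congr (γ : Val P.U D.dom) (L : List D.V) {g g' : D.Config → ENNReal}
    {ω : D.Config} (h : ∀ ω' : D.Config, (∀ a ∉ L, ω' a = ω a) → g ω' = g' ω') :
    D.resampleList γ L g ω = D.resampleList γ L g' ω := by
  classical
  induction L generalizing ω with
  | nil => exact h ω fun _ _ => rfl
  | cons a L ih =>
    refine lintegral_congr fun β => ih fun ω' hω' => h ω' fun b hb => ?_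
    rw [List.mem_cons, not_or] at hb
    rw [hω' b hb.2, Function.update_of_ne hb.1]

theorem resample_resampleList_comm (γ : Val P.U D.dom) {a : D.V} {L : List D.V}
    (h : ∀ b ∈ L, ¬ D.Precedes a b ∧ ¬ D.Precedes b a) {g : D.Config → ENNReal}
    (hg : Measurable g) :
    D.resample γ a (D.resampleList γ L g) = D.resampleList γ L (D.resample γ a g) := by
  induction L with
  | nil => rfl
  | cons b L ih =>
    have hb := h b List.mem_cons_self
    change D.resample γ a (D.resample γ b (D.resampleList γ L g)) =
      D.resample γ b (D.resampleList γ L (D.resample γ a g))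
    rw [D.resample_comm γ hb.1 hb.2 (D.measurable_resampleList γ L hg),
      ih fun c hc => h c (List.mem_cons_of_mem b hc)]

/-- Resampling along a list of vertices in which every wire goes forward does not depend on the
order of the list. -/
theorem resampleList_perm (γ : Val P.U D.dom) {L L' : List D.V} (hp : L.Perm L')
    (hL : L.Pairwise fun a b => ¬ D.Precedes b a) (hL' : L'.Pairwise fun a b => ¬ D.Precedes b a)
    {g : D.Config → ENNReal} (hg : Measurable g) :
    D.resampleList γ L g = D.resampleList γ L' g := by
  induction L generalizing L' with
  | nil => rw [hp.nil_eq]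
  | cons a L ih =>
    -- No wire joins `a` to a vertex of `M`: the order of `L'` excludes wires from `a` into `M`, and
    -- that of `L` excludes wires from `M` into `a`. So the operator of `a` moves past `M` to the
    -- front.
    obtain ⟨M, N, rfl⟩ := List.append_of_mem (hp.subset List.mem_cons_self)
    have hp' : L.Perm (M ++ N) := (hp.trans List.perm_middle).cons_inv
    rw [List.pairwise_cons] at hL
    have hMN := hL'.sublist ((List.sublist_cons_self a N).append_left M)
    rw [List.pairwise_append] at hL'
    have hM : ∀ b ∈ M, ¬ D.Precedes a b ∧ ¬ D.Precedes b a := fun b hb =>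
      ⟨hL'.2.2 b hb a List.mem_cons_self,
        hL.1 b (hp'.symm.subset (List.mem_append_left N hb))⟩
    change D.resample γ a (D.resampleList γ L g) = _
    rw [ih hp' hL.2 hMN, resampleList_append, resampleList_append,
      D.resample_resampleList_comm γ hM (D.measurable_resampleList γ N hg)]
    rfl

/-! ## Trace kernels by resampling -/

/-- The first `n` vertices of a topological ordering. -/
noncomputable def firstVertices (σ : D.TopOrder) (n : ℕ) (h : n ≤ Nat.card D.V) : List D.V :=
  (List.finRange n).map fun i => σ.rank.symm (i.castLE h)

theorem firstVertices_succ (σ : D.TopOrder) (n : ℕ) (h : n + 1 ≤ Nat.card D.V) :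
    D.firstVertices σ (n + 1) h =
      D.firstVertices σ n (Nat.le_of_succ_le h) ++ [σ.rank.symm ⟨n, h⟩] := by
  rw [firstVertices, List.finRange_succ_last, List.map_append, List.map_map]
  rfl

theorem firstVertices_pairwise (σ : D.TopOrder) (n : ℕ) (h : n ≤ Nat.card D.V) :
    (D.firstVertices σ n h).Pairwise fun a b => ¬ D.Precedes b a := by
  rw [firstVertices, List.pairwise_map]
  refine (List.pairwise_lt_finRange n).imp ?_
  rintro i j hij ⟨e, h₁, h₂⟩
  have := σ.lt e
  rw [h₁, h₂, Equiv.apply_symm_apply, Equiv.apply_symm_apply] at this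
  exact lt_asymm hij this

theorem firstVertices_nodup (σ : D.TopOrder) (n : ℕ) (h : n ≤ Nat.card D.V) :
    (D.firstVertices σ n h).Nodup :=
  (List.nodup_finRange n).map fun _ _ hij =>
    Fin.castLE_injective h (σ.rank.symm.injective hij)

theorem mem_firstVertices (σ : D.TopOrder) (a : D.V) : a ∈ D.firstVertices σ _ le_rfl :=
  List.mem_map.2 ⟨σ.rank a, List.mem_finRange _, σ.rank.symm_apply_apply a⟩

/-- The part of a configuration at the first `n` vertices. -/
def restrict (σ : D.TopOrder) (n : ℕ) (ω : D.Config) : D.Hist σ n := fun a => ω a.1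

theorem measurable_readOut (σ : D.TopOrder) : Measurable (D.readOut σ) :=
  measurable_pi_lambda _ fun _ => (measurable_castObj _).comp
    ((measurable_pi_apply _).comp (measurable_pi_apply _))

instance isMarkovKernel_traceMeasure (σ : D.TopOrder) (n : ℕ) (h : n ≤ Nat.card D.V) :
    IsMarkovKernel (D.traceMeasure σ n h) := by
  induction n with
  | zero => rw [traceMeasure]; infer_instance
  | succ n ih =>
    have := ih (Nat.le_of_succ_le h)
    rw [traceMeasure, step]
    exact Kernel.IsMarkovKernel.map _ (D.measurable_extend σ _)

/-- The last vertex drawn is the innermost operator, so the induction peels the list from its end.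
The configuration `ω` is arbitrary: its values at the listed vertices are redrawn before they are
used. -/
theorem lintegral_traceMeasure (σ : D.TopOrder) (n : ℕ) (h : n ≤ Nat.card D.V)
    (γ : Val P.U D.dom) (ω : D.Config) {g : D.Hist σ n → ENNReal} (hg : Measurable g) :
    ∫⁻ y, g y ∂D.traceMeasure σ n h γ =
      D.resampleList γ (D.firstVertices σ n h) (fun ω' => g (D.restrict σ n ω')) ω := by
  classical
  induction n with
  | zero =>
    rw [traceMeasure, Kernel.const_apply, lintegral_dirac' _ hg]
    change g _ = g _
    congr 1
    funext a
    exact absurd a.2 (Nat.not_lt_zero _)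
  | succ n ih =>
    have hm := D.measurable_extend σ (a := σ.rank.symm ⟨n, h⟩) (n := n) (by simp)
    have hm' : Measurable fun y => ∫⁻ β, g (D.extend σ (a := σ.rank.symm ⟨n, h⟩) (by simp) (y, β))
        ∂(D.label (σ.rank.symm ⟨n, h⟩)).ker (D.inputVal σ (by simp) (γ, y)) :=
      measurable_lintegral_kernel
        ((D.measurable_inputVal σ _).comp measurable_prodMk_left) _ (hg.comp hm)
    rw [traceMeasure, step, Kernel.lintegral_map _ hm _ hg,
      Kernel.lintegral_compProd (f := fun p => g (D.extend σ _ p)) _ _ _ (hg.comp hm)]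
    simp only [Kernel.comap_apply]
    rw [ih _ hm', firstVertices_succ, resampleList_append]
    congr 1
    funext ω'
    -- Wires into the vertex of rank `n` start at earlier vertices, so the restricted history
    -- already determines its inputs.
    have hin : D.inputVal σ (a := σ.rank.symm ⟨n, h⟩) (by simp) (γ, D.restrict σ n ω') =
        D.vertexIn γ ω' (σ.rank.symm ⟨n, h⟩) := rfl
    rw [hin]
    refine lintegral_congr fun β => ?_
    congr 1
    funext ⟨a, ha⟩
    by_cases h' : (σ.rank a : ℕ) < n
    · have hne : a ≠ σ.rank.symm ⟨n, h⟩ := by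
        rintro rfl
        simp at h'
      simp [extend, restrict, h', Function.update_of_ne hne]
    · obtain rfl : a = σ.rank.symm ⟨n, h⟩ := by
        rw [Equiv.eq_symm_apply]
        exact Fin.ext (by simp only; omega)
      simp [extend, restrict, Val.cast]

/-- The spaces of objects may be empty, so a configuration to start resampling from is not
automatic. Given an external input, the trace measure is a probability measure, which forces its
space to be nonempty. -/
theorem nonempty_config (σ : D.TopOrder) (γ : Val P.U D.dom) : Nonempty D.Config := by
  obtain ⟨y⟩ := nonempty_of_isProbabilityMeasure (D.traceMeasure σ _ le_rfl γ)
  exact ⟨fun a => y ⟨a, (σ.rank a).2⟩⟩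

theorem lintegral_traceKernelAlong (σ : D.TopOrder) (γ : Val P.U D.dom) (ω : D.Config)
    {g : Val P.U D.cod → ENNReal} (hg : Measurable g) :
    ∫⁻ o, g o ∂D.traceKernelAlong σ γ = D.resampleList γ (D.firstVertices σ _ le_rfl)
      (fun ω' => g (D.readOut σ (D.restrict σ _ ω'))) ω := by
  have hm := D.measurable_readOut σ
  rw [traceKernelAlong, Kernel.lintegral_map _ hm _ hg]
  exact D.lintegral_traceMeasure σ _ _ γ ω (hg.comp hm)

end KSCDiagram

/-! ### Tuples read off slots, and auxiliary facts -/

/-- Reading the values of the slots in a list. -/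
def Val.read {Ob : Type u} {U : Ob → Type v} {T : Type w} (ob : T → Ob) (f : ∀ s, U (ob s))
    (l : List T) : Val U (l.map ob) := fun r =>
  castObj U (by simp) (f (l.get (r.cast (by simp))))

@[simp] theorem Val.toList_read {Ob : Type u} {U : Ob → Type v} {T : Type w} (ob : T → Ob)
    (f : ∀ s, U (ob s)) (l : List T) :
    (Val.read ob f l).toList = l.map fun s => ⟨ob s, f s⟩ := by
  refine List.ext_getElem (by simp) fun r h₁ h₂ => ?_
  rw [Val.getElem_toList, List.getElem_map]
  exact Val.sigma_castObj _ _

theorem Val.measurable_read {Ob : Type u} {U : Ob → Type v} [∀ X, MeasurableSpace (U X)]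
    {T : Type w} {Z : Type*} [MeasurableSpace Z] (ob : T → Ob) {f : Z → ∀ s, U (ob s)}
    (hf : ∀ s, Measurable fun p => f p s) (l : List T) :
    Measurable fun p => Val.read ob (f p) l :=
  measurable_pi_lambda _ fun _ => (measurable_castObj _).comp (hf _)

theorem MarkovPolycategory.Mor.lintegral_cast {P : MarkovPolycategory.{u, v}}
    {A B A' B' : List P.Ob} (hA : A = A') (hB : B = B') (k : P.Mor A B) (γ : Val P.U A')
    (g : Val P.U B' → ENNReal) :
    ∫⁻ o, g o ∂(k.cast hA hB).ker γ = ∫⁻ o, g (o.cast hB) ∂k.ker (γ.cast hA.symm) := by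
  subst hA hB; rfl

/-- This turns "the source of each wire occurs before its target" into "no wire goes backward". -/
theorem List.Nodup.not_sublist_pair_swap {α : Type*} {l : List α} (h : l.Nodup) {a b : α}
    (hab : [a, b].Sublist l) : ¬ [b, a].Sublist l := by
  induction l with
  | nil => simp at hab
  | cons c l ih =>
    rw [List.nodup_cons] at h
    intro hba
    rw [List.cons_sublist_cons'] at hab hba
    have hmem : ∀ {d e : α}, [d, e].Sublist l → d ∈ l ∧ e ∈ l := fun hs =>
      ⟨hs.subset (by simp), hs.subset (by simp)⟩
    rcases hab with hab | ⟨rfl, hab⟩ <;> rcases hba with hba | ⟨rfl, hba⟩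
    · exact ih h.2 hab hba
    · exact h.1 (hmem hab).2
    · exact h.1 (hmem hba).2
    · exact h.1 (by simpa using hab)

namespace CKSCDiagram

variable {S : ColorSystem.{x, y, z}} {P : CMP.{u, v} S} {D : CKSCDiagram.{u, v, w} P}

namespace Expr

/-! ## Combinatorics of expressions -/

theorem fst_mem_vertices {I : List D.InSlot} {O : List D.OutSlot} (E : D.Expr I O) :
    (∀ s ∈ I, s.1 ∈ E.vertices) ∧ ∀ s ∈ O, s.1 ∈ E.vertices := by
  induction E with
  | vertex a => simp [vertices, Wiring.inSlots, Wiring.outSlots]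
  | comp e E₁ E₂ h₁ h₂ =>
    simp only [vertices, List.mem_append, List.mem_cons] at h₁ h₂ ⊢
    grind

theorem wire_mem_vertices {I : List D.InSlot} {O : List D.OutSlot} (E : D.Expr I O) :
    ∀ e ∈ E.wires, (D.src e).1 ∈ E.vertices ∧ (D.tgt e).1 ∈ E.vertices := by
  induction E with
  | vertex a => simp [wires]
  | comp e E₁ E₂ h₁ h₂ =>
    have h₃ := E₁.fst_mem_vertices.2 (D.src e) (by simp)
    have h₄ := E₂.fst_mem_vertices.1 (D.tgt e) (by simp)
    simp only [vertices, wires, List.mem_append, List.mem_cons] at h₁ h₂ ⊢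
    grind

/-- External inputs lie on vertices of the expression, and the two factors of a composite have
disjoint vertices. The result guarantees that the slot `D.tgt e` filled by a composition is not also
among the remaining inputs. -/
theorem nodup_inputs {I : List D.InSlot} {O : List D.OutSlot} (E : D.Expr I O)
    (h : E.vertices.Nodup) : I.Nodup := by
  induction E with
  | vertex a => exact (List.nodup_finRange _).map fun _ _ h => by simpa using h
  | comp e E₁ E₂ h₁ h₂ =>
    rw [vertices, List.nodup_append'] at h
    have hd : ∀ s : D.InSlot, s.1 ∈ E₁.vertices → s.1 ∉ E₂.vertices := fun s => @h.2.2 s.1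
    have h₃ := E₁.fst_mem_vertices.1
    have h₄ := E₂.fst_mem_vertices.1
    have h₅ := h₁ h.1
    have h₆ := h₂ h.2.1
    simp only [List.nodup_append', List.nodup_cons, List.mem_append, List.mem_cons,
      List.Disjoint] at *
    grind

/-- The vertices of the interface expansion that occur in an expression, in the order of
evaluation. -/
def order : ∀ {I : List D.InSlot} {O : List D.OutSlot}, D.Expr I O → List (D.V ⊕ D.W)
  | _, _, .vertex a => [.inl a]
  | _, _, .comp e E₁ E₂ => E₁.order ++ .inr e :: E₂.order

theorem inl_mem_order {I : List D.InSlot} {O : List D.OutSlot} (E : D.Expr I O) {a : D.V} :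
    .inl a ∈ E.order ↔ a ∈ E.vertices := by
  induction E with
  | vertex a => simp [order, vertices]
  | comp e E₁ E₂ h₁ h₂ => simp [order, vertices, h₁, h₂]

theorem inr_mem_order {I : List D.InSlot} {O : List D.OutSlot} (E : D.Expr I O) {e : D.W} :
    .inr e ∈ E.order ↔ e ∈ E.wires := by
  induction E with
  | vertex a => simp [order, wires]
  | comp e E₁ E₂ h₁ h₂ => simp [order, wires, h₁, h₂]; tauto

theorem nodup_order {I : List D.InSlot} {O : List D.OutSlot} (E : D.Expr I O)
    (h : E.vertices.Nodup) (h' : E.wires.Nodup) : E.order.Nodup := by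
  induction E with
  | vertex a => simp [order]
  | comp e E₁ E₂ h₁ h₂ =>
    have hw := List.perm_middle.nodup_iff.2 h'
    rw [vertices, List.nodup_append'] at h
    rw [List.nodup_append', List.nodup_cons] at hw
    rw [order, List.nodup_append', List.nodup_cons, E₂.inr_mem_order]
    refine ⟨h₁ h.1 hw.1, ⟨hw.2.1.1, h₂ h.2.1 hw.2.1.2⟩, ?_⟩
    rintro (a | e') hm hm'
    · exact h.2.2 (E₁.inl_mem_order.1 hm) (E₂.inl_mem_order.1 (by simpa using hm'))
    · refine hw.2.2 (E₁.inr_mem_order.1 hm) ?_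
      simpa [E₂.inr_mem_order] using hm'

/-- The wire of a composition leaves a vertex of `E₁` and enters a vertex of `E₂`, and its interface
vertex is listed between the two blocks. -/
theorem sublist_order {I : List D.InSlot} {O : List D.OutSlot} (E : D.Expr I O) :
    ∀ e ∈ E.wires, [.inl (D.src e).1, .inr e, .inl (D.tgt e).1].Sublist E.order := by
  induction E with
  | vertex a => simp [wires]
  | comp e E₁ E₂ h₁ h₂ =>
    intro e' he'
    rw [wires, List.mem_cons, List.mem_append] at he'
    rcases he' with rfl | he' | he'
    · have h₃ := E₁.inl_mem_order.2 (E₁.fst_mem_vertices.2 (D.src e') (by simp))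
      have h₄ := E₂.inl_mem_order.2 (E₂.fst_mem_vertices.1 (D.tgt e') (by simp))
      exact (List.singleton_sublist.2 h₃).append ((List.singleton_sublist.2 h₄).cons_cons _)
    · exact (h₁ e' he').trans (List.sublist_append_left _ _)
    · exact (h₂ e' he').trans ((List.sublist_cons_self _ _).trans (List.sublist_append_right _ _))

theorem pairwise_order {I : List D.InSlot} {O : List D.OutSlot} {E : D.Expr I O}
    (h : E.Realizes) :
    List.Pairwise (α := D.V ⊕ D.W) (fun a b => ¬ D.expansion.Precedes b a) E.order := by
  rw [List.pairwise_iff_forall_sublist]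
  rintro a b hab ⟨e, rfl, rfl⟩
  refine (E.nodup_order h.vertices_nodup h.wires_nodup).not_sublist_pair_swap hab ?_
  -- The two halves of a wire of `D` are the two consecutive pairs in the triple source, interface,
  -- target.
  rcases e with e | e
  · exact (((List.nil_sublist [_]).cons_cons _).cons_cons _).trans
      (E.sublist_order e (h.mem_wires e))
  · exact (List.sublist_cons_self _ _).trans (E.sublist_order e (h.mem_wires e))

end Expr

/-! ## Values of expressions by resampling -/

/-- The value in an output slot of `D`. -/
def outputAt (ω : D.expansion.Config) (s : D.OutSlot) : P.U (D.outOb s) := ω (.inl s.1) s.2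

/-- The value behind the interface of a wire. -/
def interfaceAt (ω : D.expansion.Config) (e : D.W) : Val P.U [D.inOb (D.tgt e)] := ω (.inr e)

/-- The value in an input slot of `D`. -/
noncomputable def inputAt (γ : Val P.U D.dom) (ω : D.expansion.Config) (s : D.InSlot) :
    P.U (D.inOb s) := D.expansion.slotIn γ ω (D.embIn s)

/-- The values in the input slots of a list. -/
noncomputable def inputsAt (γ : Val P.U D.dom) (ω : D.expansion.Config) (I : List D.InSlot) :
    Val P.U (I.map D.inOb) := Val.read D.inOb (inputAt γ ω) I

/-- The values in the output slots of a list. -/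
def outputsAt (ω : D.expansion.Config) (O : List D.OutSlot) : Val P.U (O.map D.outOb) :=
  Val.read D.outOb (outputAt ω) O

theorem toList_inputsAt (γ : Val P.U D.dom) (ω : D.expansion.Config) (I : List D.InSlot) :
    (inputsAt γ ω I).toList = I.map fun s => ⟨D.inOb s, inputAt γ ω s⟩ :=
  Val.toList_read _ _ _

theorem toList_outputsAt (ω : D.expansion.Config) (O : List D.OutSlot) :
    (outputsAt ω O).toList = O.map fun s => ⟨D.outOb s, outputAt ω s⟩ :=
  Val.toList_read _ _ _

theorem measurable_outputAt (s : D.OutSlot) :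
    Measurable fun ω : D.expansion.Config => outputAt ω s := by
  have h : Measurable fun ω : D.expansion.Config => ω (.inl s.1) := measurable_pi_apply _
  exact (measurable_pi_apply (X := fun r => P.U ((D.out s.1).get r)) s.2).comp h

theorem measurable_outputsAt (O : List D.OutSlot) :
    Measurable fun ω : D.expansion.Config => outputsAt ω O :=
  Val.measurable_read _ measurable_outputAt O

/-- In the expansion an input slot of `D` is fed only by an interface vertex or by an external
input. -/
theorem inputAt_congr (γ : Val P.U D.dom) {ω ω' : D.expansion.Config} {s : D.InSlot}
    (h : ∀ e, D.tgt e = s → interfaceAt ω e = interfaceAt ω' e) :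
    inputAt γ ω s = inputAt γ ω' s := by
  refine D.expansion.slotIn_congr γ ?_
  rintro (e | e) he
  · exact absurd (congrArg Sigma.fst he) (by simp [expansion, expWiring, expTgt, embIn])
  · exact h e (D.embIn_injective he)

theorem inputAt_tgt (γ : Val P.U D.dom) (ω : D.expansion.Config) (e : D.W) :
    inputAt γ ω (D.tgt e) = interfaceAt ω e (0 : Fin 1) := by
  have h : (⟨D.inOb (D.tgt e), inputAt γ ω (D.tgt e)⟩ : Σ X, P.U X) =
      ⟨D.inOb (D.tgt e), interfaceAt ω e (0 : Fin 1)⟩ :=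
    D.expansion.slotIn_of_tgt γ ω (e := .inr e) rfl
  simpa using h

theorem vertexIn_inr (γ : Val P.U D.dom) (ω : D.expansion.Config) (e : D.W) :
    D.expansion.vertexIn γ ω (.inr e) = Val.single (outputAt ω (D.src e)) := by
  apply Val.toList_injective
  exact congrArg (fun p => [p])
    (D.expansion.slotIn_of_tgt γ ω (s := ⟨.inr e, (0 : Fin 1)⟩) (e := .inl e) rfl)

theorem vertexIn_inl (γ : Val P.U D.dom) (ω : D.expansion.Config) (a : D.V) :
    D.expansion.vertexIn γ ω (.inl a) =
      (inputsAt γ ω (D.inSlots a)).cast (D.map_inSlots a) := by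
  apply Val.toList_injective
  refine Eq.trans ?_ (Val.toList_cast _ _).symm
  rw [toList_inputsAt, Wiring.inSlots, List.map_map]
  exact List.ofFn_eq_map

open Classical in
/-- The effect of resampling a vertex of `D` on the values. -/
noncomputable def setVertex (ω : D.expansion.Config) (a : D.V) (β : Val P.U (D.out a)) :
    D.expansion.Config := Function.update ω (.inl a) β

open Classical in
/-- The effect of resampling the interface of a wire on the values. -/
noncomputable def setInterface (ω : D.expansion.Config) (e : D.W)
    (τ : Val P.U [D.inOb (D.tgt e)]) : D.expansion.Config := Function.update ω (.inr e) τ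

theorem outputAt_setVertex (ω : D.expansion.Config) (a : D.V) (β : Val P.U (D.out a))
    (r : Fin (D.out a).length) : outputAt (setVertex ω a β) ⟨a, r⟩ = β r := by
  classical exact congrFun (Function.update_self (α := D.expansion.V) (.inl a) β ω) r

theorem outputAt_setInterface (ω : D.expansion.Config) (e : D.W)
    (τ : Val P.U [D.inOb (D.tgt e)]) (s : D.OutSlot) :
    outputAt (setInterface ω e τ) s = outputAt ω s := by
  classical exact congrFun (Function.update_of_ne (α := D.expansion.V)
    (a := .inl s.1) (a' := .inr e) Sum.inl_ne_inr τ ω) s.2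

theorem interfaceAt_setInterface_self (ω : D.expansion.Config) (e : D.W)
    (τ : Val P.U [D.inOb (D.tgt e)]) : interfaceAt (setInterface ω e τ) e = τ := by
  classical exact Function.update_self (α := D.expansion.V) (.inr e) τ ω

theorem interfaceAt_setInterface_of_ne (ω : D.expansion.Config) {e e' : D.W} (h : e' ≠ e)
    (τ : Val P.U [D.inOb (D.tgt e)]) :
    interfaceAt (setInterface ω e τ) e' = interfaceAt ω e' := by
  classical
  exact Function.update_of_ne (α := D.expansion.V)
    (a := .inr e') (a' := .inr e) (fun h' => h (Sum.inr_injective h')) τ ω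

theorem outputsAt_setVertex (ω : D.expansion.Config) (a : D.V) (β : Val P.U (D.out a)) :
    outputsAt (setVertex ω a β) (D.outSlots a) = β.cast (D.map_outSlots a).symm := by
  apply Val.toList_injective
  rw [Val.toList_cast, toList_outputsAt, Wiring.outSlots, List.map_map, Val.toList,
    List.ofFn_eq_map]
  refine List.map_congr_left fun r _ => ?_
  simp only [Function.comp_apply, outputAt_setVertex]
  rfl

theorem resample_inl (γ : Val P.U D.dom) (a : D.V) (g : D.expansion.Config → ENNReal)
    (ω : D.expansion.Config) :
    D.expansion.resample γ (.inl a) g ω = ∫⁻ β, g (setVertex ω a β)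
      ∂(D.label a).ker ((inputsAt γ ω (D.inSlots a)).cast (D.map_inSlots a)) := by
  rw [← vertexIn_inl]
  rfl

theorem resample_inr (γ : Val P.U D.dom) (e : D.W) (g : D.expansion.Config → ENNReal)
    (ω : D.expansion.Config) :
    D.expansion.resample γ (.inr e) g ω = ∫⁻ τ, g (setInterface ω e τ)
      ∂(P.κ (D.wit e)).ker (Val.single (outputAt ω (D.src e))) := by
  rw [← vertexIn_inr γ]
  rfl

/-- For a composite, the three blocks of the order match the three integrals of `lintegral_cksc`.
Two independence facts make this work: resampling `E₁` leaves the inputs of `E₂` other than `D.tgt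
e` unchanged, and resampling `E₂` leaves the outputs of `E₁` unchanged. Both come from disjointness
of vertices; it is not required that the whole diagram be covered, so the induction applies to
subexpressions. -/
theorem resampleList_order {I : List D.InSlot} {O : List D.OutSlot} (E : D.Expr I O)
    (hE : E.vertices.Nodup) (γ : Val P.U D.dom) {g : Val P.U (O.map D.outOb) → ENNReal}
    (hg : Measurable g) (ω : D.expansion.Config) :
    D.expansion.resampleList γ E.order (fun ω' => g (outputsAt ω' O)) ω =
      ∫⁻ o, g o ∂E.value.ker (inputsAt γ ω I) := by
  induction E generalizing ω with
  | vertex a =>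
    rw [Expr.value, MarkovPolycategory.Mor.lintegral_cast]
    refine (resample_inl γ a _ ω).trans (lintegral_congr fun β => ?_)
    exact congrArg g (outputsAt_setVertex ω a β)
  | @comp I₁ I I₂ O₁ O O₂ e E₁ E₂ ih₁ ih₂ =>
    rw [Expr.vertices, List.nodup_append'] at hE
    obtain ⟨hE₁, hE₂, hd⟩ := hE
    have hI := E₂.nodup_inputs hE₂
    have hO₂ : ∀ s ∈ O₁ ++ D.src e :: O₂, s.1 ∉ E₂.vertices := fun s hs =>
      @hd s.1 (E₁.fst_mem_vertices.2 s hs)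
    have hI₁ : ∀ s ∈ I₁ ++ D.tgt e :: I₂, s.1 ∉ E₁.vertices := fun s hs h =>
      @hd s.1 h (E₂.fst_mem_vertices.1 s hs)
    rw [Expr.value, CMP.lintegral_cksc _ _ _ _ _ hg]
    -- Only the positions of the connected slots are needed from here on.
    generalize hs : (SlotPair.mk (O₁.map D.outOb) (O₂.map D.outOb) (I₁.map D.inOb)
      (I₂.map D.inOb) _ _ _ _ : SlotPair (I.map D.inOb) _ _ (O.map D.outOb) _ _ _ _) = s
    have hB₁ : s.B₁ = O₁.map D.outOb := by rw [← hs]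
    have hC₁ : s.C₁ = I₁.map D.inOb := by rw [← hs]
    clear hs
    have hK : s.inK (inputsAt γ ω (I₁ ++ I ++ I₂)) = inputsAt γ ω I := by
      apply Val.toList_injective
      rw [SlotPair.toList_inK_eq _ (by rw [toList_inputsAt, List.map_append, List.map_append]),
        toList_inputsAt]
      all_goals simp [hC₁]
    rw [hK, ← ih₁ hE₁ (P.measurable_ckscTail _ _ _ hg _)]
    refine (congrFun (D.expansion.resampleList_append γ E₁.order (.inr e :: E₂.order) _) ω).trans ?_
    refine D.expansion.resampleList_congr γ E₁.order fun ω₁ hω₁ => ?_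
    have hat : s.atSlot (outputsAt ω₁ (O₁ ++ D.src e :: O₂)) = outputAt ω₁ (D.src e) :=
      s.atSlot_eq_of_append (by rw [toList_outputsAt, List.map_append, List.map_cons])
        (by simp [hB₁])
    refine (resample_inr γ e _ ω₁).trans ?_
    rw [CMP.ckscTail, hat]
    refine lintegral_congr fun τ => ?_
    have hin : s.inL (inputsAt γ ω (I₁ ++ I ++ I₂)) (τ (0 : Fin 1)) =
        inputsAt γ (setInterface ω₁ e τ) (I₁ ++ D.tgt e :: I₂) := by
      -- A wire `e'` into such a slot is not `e`, as the inputs of `E₂` are distinct, and does not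
      -- occur in `E₁`, as its target is a vertex of `E₂`. Its interface value is therefore still
      -- the one in `ω`.
      have hr : ∀ r ∈ I₁ ++ I₂,
          inputAt γ ω r = inputAt γ (setInterface ω₁ e τ) r := by
        intro r hr
        refine inputAt_congr γ fun e' he' => ?_
        have hne : e' ≠ e := by
          rintro rfl
          exact (List.nodup_cons.1 (List.nodup_middle.1 hI)).1 (he' ▸ hr)
        rw [interfaceAt_setInterface_of_ne _ hne]
        refine (hω₁ (.inr e') fun hm => hI₁ r (by simp at hr ⊢; tauto) ?_).symm
        exact he' ▸ (E₁.wire_mem_vertices e' (E₁.inr_mem_order.1 hm)).2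
      apply Val.toList_injective
      rw [SlotPair.toList_inL_eq _ (by rw [toList_inputsAt, List.map_append, List.map_append]),
        toList_inputsAt, List.map_append, List.map_cons, inputAt_tgt,
        interfaceAt_setInterface_self]
      · congr 1
        · exact List.map_congr_left fun r h => by rw [hr r (by simp [h])]
        · congr 1
          exact List.map_congr_left fun r h => by rw [hr r (by simp [h])]
      all_goals simp [hC₁]
    rw [hin]
    -- The observable for `E₂` has the outputs of `E₁` frozen at `ω₁`; `ho` below justifies the
    -- freezing.
    refine Eq.trans ?_ (ih₂ hE₂ (hg.comp (s.measurable_outKL.comp measurable_prodMk_left)) _)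
    refine D.expansion.resampleList_congr γ E₂.order fun ω₂ hω₂ => ?_
    have ho : ∀ r ∈ O₁ ++ O₂, outputAt ω₂ r = outputAt ω₁ r := by
      intro r hr
      rw [← outputAt_setInterface ω₁ e τ r]
      exact congrFun (hω₂ (.inl r.1) fun hm =>
        hO₂ r (by simp at hr ⊢; tauto) (E₂.inl_mem_order.1 hm)) r.2
    refine congrArg g (Val.toList_injective (Eq.symm ?_))
    refine (s.toList_outKL_eq (β := outputsAt ω₁ (O₁ ++ D.src e :: O₂))
      (by rw [toList_outputsAt, List.map_append, List.map_cons]) (by simp [hB₁])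
      (outputsAt ω₂ O)).trans ?_
    rw [toList_outputsAt, toList_outputsAt, List.map_append, List.map_append,
      List.map_congr_left (l := O₁) fun r h => by rw [← ho r (by simp [h])],
      List.map_congr_left (l := O₂) fun r h => by rw [← ho r (by simp [h])]]

/-! ## Trace kernels -/

theorem inputsAt_extIn (γ : Val P.U D.dom) (ω : D.expansion.Config) :
    inputsAt γ ω D.extIn = γ := by
  apply Val.toList_injective
  rw [toList_inputsAt]
  refine List.ext_getElem (by simp) fun r h₁ h₂ => ?_
  rw [List.length_map] at h₁
  have hr : r < D.expansion.extIn.length := by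
    change r < (D.extIn.map D.embIn).length
    simpa using h₁
  have hs : D.expansion.extIn[r] = D.embIn D.extIn[r] := List.getElem_map _
  rw [List.getElem_map, Val.getElem_toList]
  refine Eq.trans ?_ (D.expansion.slotIn_extIn γ ω hr)
  rw [hs]
  rfl

theorem readOut_restrict (σ : D.expansion.TopOrder) (ω : D.expansion.Config) :
    D.expansion.readOut σ (D.expansion.restrict σ _ ω) = outputsAt ω D.extOut := by
  apply Val.toList_injective
  refine Eq.trans ?_ (toList_outputsAt ω D.extOut).symm
  refine List.ext_getElem (by simp [expansion]) fun r h₁ h₂ => ?_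
  rw [List.length_map] at h₂
  have hr : r < D.expansion.extOut.length := by
    change r < (D.extOut.map D.embOut).length
    simpa using h₂
  have hs : D.expansion.extOut[r] = D.embOut D.extOut[r] := List.getElem_map _
  rw [List.getElem_map, Val.getElem_toList]
  refine (Val.sigma_castObj (U := P.U) _ _).trans ?_
  change (⟨D.expansion.outOb D.expansion.extOut[r],
    ω D.expansion.extOut[r].1 D.expansion.extOut[r].2⟩ : Σ X, P.U X) = _
  rw [hs]
  rfl

/-- The order of `E` and the ordering `σ` both enumerate the vertices of the expansion exactly once
without backward wires, so resampling along them agrees. -/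
theorem value_eq_traceKernelAlong {E : D.Expr D.extIn D.extOut} (hE : E.Realizes)
    (σ : D.expansion.TopOrder) : E.value.ker = D.expansion.traceKernelAlong σ := by
  refine Kernel.ext fun γ => Measure.ext_of_lintegral _ fun g hg => ?_
  obtain ⟨ω⟩ := D.expansion.nonempty_config σ γ
  have hm : Measurable fun ω' : D.expansion.Config => g (outputsAt ω' D.extOut) :=
    hg.comp (measurable_outputsAt _)
  have hp : E.order.Perm (D.expansion.firstVertices σ _ le_rfl) := by
    refine (List.perm_ext_iff_of_nodup (E.nodup_order hE.vertices_nodup hE.wires_nodup)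
      (D.expansion.firstVertices_nodup σ _ _)).2 ?_
    rintro (a | e)
    · exact iff_of_true (E.inl_mem_order.2 (hE.mem_vertices a))
        (D.expansion.mem_firstVertices σ (.inl a))
    · exact iff_of_true (E.inr_mem_order.2 (hE.mem_wires e))
        (D.expansion.mem_firstVertices σ (.inr e))
  have h₁ := resampleList_order E hE.vertices_nodup γ hg ω
  rw [inputsAt_extIn] at h₁
  refine h₁.symm.trans ?_
  refine (congrFun (D.expansion.resampleList_perm γ hp (Expr.pairwise_order hE)
    (D.expansion.firstVertices_pairwise σ _ _) hm) ω).trans ?_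
  refine Eq.trans ?_ (D.expansion.lintegral_traceKernelAlong σ γ ω hg).symm
  simp only [readOut_restrict]

end CKSCDiagram

theorem mainTheorem4 {S : ColorSystem.{x, y, z}} (P : CMP.{u, v} S) :
    (∀ (D : CKSCDiagram.{u, v, w} P) (E : D.Expr D.extIn D.extOut), E.Realizes →
      E.value.ker = D.traceKernel ∧
      ∀ σ : D.expansion.TopOrder, E.value.ker = D.expansion.traceKernelAlong σ) ∧
    (∀ (D : CKSCDiagram.{u, v, w} P) (E E' : D.Expr D.extIn D.extOut),
      E.Realizes → E'.Realizes → E.value = E'.value) ∧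
    P.CKSCAssociative ∧ P.CKSCInterchangeOut ∧ P.CKSCInterchangeIn := by
  refine ⟨fun D E hE => ⟨CKSCDiagram.value_eq_traceKernelAlong hE _,
      CKSCDiagram.value_eq_traceKernelAlong hE⟩, fun D E E' hE hE' => Subtype.ext ?_,
    P.cksc_associative, P.cksc_interchange_out, P.cksc_interchange_in⟩
  obtain ⟨σ⟩ := D.expansion.exists_topOrder
  exact (CKSCDiagram.value_eq_traceKernelAlong hE σ).trans
    (CKSCDiagram.value_eq_traceKernelAlong hE' σ).symm
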